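/- \textbf{Theorem (compressive sensing: local error bound and complexity of LoPNAG).} Let $A\in\mathbb R^{m\times d}$, $y\in\mathbb R^m$, $\tau\in\mathbb R$, let $\|\cdot\|$ be the Euclidean norm, and put \[ f(x)=\|x\|_1,\qquad c(x)=\|Ax-y\|^2-\tau,\qquad \Omega=\{x\in\mathbb R^d: c(x)\le 0\}. \] Let $f_*=\inf_\Omega f$ and let $\Omega_*$ be the set of minimizers of $f$ over $\Omega$. Assume that there is $x_0$ with $c(x_0)<0$ and that $0\notin\Omega_*$. \emph{(1) Local error bound.} $\Omega_*\ne\emptyset$, and for every $\epsilon>0$ there is $0<\sigma<\infty$ such that for all $x\in\mathbb R^d$ with $c(x)\le 0$ and $f(x)\le f_*+\epsilon$, \[ \mathrm{dist}(x,\Omega_*)\le\sigma\,(f(x)-f_*)^{1/2}. \] \emph{(2) Complexity.} Let $\Pi_\Omega$ be the Euclidean projection onto $\Omega$, $[s]_+=\max(s,0)$, and $h_\gamma(x)=\gamma\ln\bigl(1+\exp(\lambda c(x)/\gamma)\bigr)$. The following constants exist: $\rho>0$ with \[ \|\Pi_\Omega[x]-x\|\le [c(x)]_+/\rho\quad\text{for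 all }x\in\mathbb R^d,\tag{a} \] and $L_c,G_c>0$ such that, for all $\lambda,\gamma>0$, \[ \nabla h_\gamma\ \text{ is Lipschitz with constant }\ L_\gamma=\lambda L_c+\frac{\lambda^2G_c^2}{4\gamma}.\tag{b} \] Now let $\rho>0$ satisfy (a), let $\lambda>\sqrt d/\rho$, let $L_c,G_c\ge 0$ satisfy (b) for this $\lambda$ and all $\gamma>0$, and let $p=\lambda\rho/(\lambda\rho-\sqrt d)$. Let $\epsilon_0,\epsilon_1,\sigma>0$ be such that the error bound in (1) holds with constant $\sigma$ for all $x\in\Omega$ with $f(x)\le f_*+\epsilon_1$. For $0<\epsilon<\epsilon_0$ and $x_0\in\Omega$ with $f(x_0)-f_*\le\epsilon_0$, LoPNAG (in its proximal form) runs $K=\lceil\log_2(\epsilon_0/\epsilon)\rceil$ epochs. Epoch $k=1,\dots,K$ uses \[ \gamma_k=\frac{\epsilon_0}{2^{k-1}\,6p\ln 2},\qquad L_k=L_{\gamma_k},\qquad t_k=\Bigl\lceil\frac{\sigma}{\sqrt\epsilon}\max\Bigl\{\lambda G_cp\sqrt{18\ln 2},\ \sqrt{12\,p\,\lambda L_c\,\epsilon_0/2^{k-1}}\Bigr\}\Bigr\rceil,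 \] starts from $x^k_0=y^k_0=x_{k-1}$, performs for $s=0,\dots,t_k-1$ the iterations \[ x^k_{s+1}=\arg\min_{u\in\mathbb R^d}\ \|u\|_1+\frac{L_k}{2}\Bigl\|u-\Bigl(y^k_s-\tfrac1{L_k}\nabla h_{\gamma_k}(y^k_s)\Bigr)\Bigr\|^2,\qquad y^k_{s+1}=x^k_{s+1}+\frac{\tau_s-1}{\tau_{s+1}}\,(x^k_{s+1}-x^k_s), \] where $\tau_0=1$ and $\tau_{s+1}=\bigl(1+\sqrt{1+4\tau_s^2}\bigr)/2$, and ends with one projection $x_k=\Pi_\Omega[x^k_{t_k}]$. Then there is a constant $C$, depending on neither $\epsilon$ nor $x_0$, such that for all $0<\epsilon\le\min\{\epsilon_1,1/2\}$ with $\epsilon<\epsilon_0$ and all such $x_0$: $x_K\in\Omega$ and $f(x_K)-f_*\le 2\epsilon$; the total number of iterations is at most $\frac{C}{\sqrt\epsilon}\log\frac1\epsilon$, i.e. $\widetilde O(1/\sqrt\epsilon)$; and the number of projections is at most $C\log\frac1\epsilon$. -/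

import Mathlib

open scoped Matrix

noncomputable section

namespace CompressiveSensing

/-- `ℝⁿ` with the Euclidean norm. -/
abbrev Vec (n : ℕ) := EuclideanSpace ℝ (Fin n)

/-- A minimizer of `g` over `S` (every use below is at a problem with exactly one minimizer). -/
def argminOn {E : Type*} [Nonempty E] (S : Set E) (g : E → ℝ) : E :=
  Classical.epsilon fun u => u ∈ S ∧ ∀ v ∈ S, g u ≤ g v

/-- `g` is `L`-smooth: it has an `L`-Lipschitz gradient. -/
def IsSmooth {d : ℕ} (g : Vec d → ℝ) (L : ℝ) : Prop :=
  Differentiable ℝ g ∧ ∀ x z, ‖gradient g x - gradient g z‖ ≤ L * ‖x - z‖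

section Problem

variable {m d : ℕ}

/-- The objective `f(x) = ‖x‖₁`. -/
def l1Norm (x : Vec d) : ℝ := ∑ i, |x i|

/-- The constraint function `c(x) = ‖A x - y‖² - τ`. -/
def constr (A : Matrix (Fin m) (Fin d) ℝ) (y : Vec m) (τ : ℝ) (x : Vec d) : ℝ :=
  ‖WithLp.toLp 2 (A *ᵥ x.ofLp) - y‖ ^ 2 - τ

/-- The feasible set `Ω = {x : c(x) ≤ 0}`. -/
def feasibleSet (A : Matrix (Fin m) (Fin d) ℝ) (y : Vec m) (τ : ℝ) : Set (Vec d) :=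
  {x | constr A y τ x ≤ 0}

/-- The optimal value `f_*` of `min ‖x‖₁` subject to `c(x) ≤ 0`. -/
def optVal (A : Matrix (Fin m) (Fin d) ℝ) (y : Vec m) (τ : ℝ) : ℝ :=
  sInf (l1Norm '' feasibleSet A y τ)

/-- The optimal set `Ω_*`. -/
def optSet (A : Matrix (Fin m) (Fin d) ℝ) (y : Vec m) (τ : ℝ) : Set (Vec d) :=
  {x | x ∈ feasibleSet A y τ ∧ ∀ u ∈ feasibleSet A y τ, l1Norm x ≤ l1Norm u}

/-- The `ε`-sublevel set `S_ε = {x ∈ Ω : f(x) ≤ f_* + ε}`. -/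
def sublevelSet (A : Matrix (Fin m) (Fin d) ℝ) (y : Vec m) (τ ε : ℝ) : Set (Vec d) :=
  {x | x ∈ feasibleSet A y τ ∧ l1Norm x ≤ optVal A y τ + ε}

/-- Local error bound on `S_ε` with exponent `θ` and constant `σ`:
`dist(x, Ω_*) ≤ σ (f(x) - f_*)^θ` for all `x ∈ S_ε`. -/
def LocalErrorBound (A : Matrix (Fin m) (Fin d) ℝ) (y : Vec m) (τ θ σ ε : ℝ) : Prop :=
  ∀ x ∈ sublevelSet A y τ ε,
    Metric.infDist x (optSet A y τ) ≤ σ * (l1Norm x - optVal A y τ) ^ θ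

/-- The projection `Π_Ω[x] = argmin_{u ∈ Ω} ‖u - x‖²`. -/
def proj (A : Matrix (Fin m) (Fin d) ℝ) (y : Vec m) (τ : ℝ) (x : Vec d) : Vec d :=
  argminOn (feasibleSet A y τ) fun u => ‖u - x‖ ^ 2

/-- Regularity of the constraint: `‖Π_Ω[x] - x‖ ≤ [c(x)]₊ / ρ` for all `x`. -/
def ConstraintRegular (A : Matrix (Fin m) (Fin d) ℝ) (y : Vec m) (τ ρ : ℝ) : Prop :=
  ∀ x : Vec d, ‖proj A y τ x - x‖ ≤ max (constr A y τ x) 0 / ρ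

/-- The penalty `h_γ(x) = γ ln(1 + exp(λ c(x) / γ))`. -/
def penalty (A : Matrix (Fin m) (Fin d) ℝ) (y : Vec m) (τ lam γ : ℝ) (x : Vec d) : ℝ :=
  γ * Real.log (1 + Real.exp (lam * constr A y τ x / γ))

end Problem

section Algorithm

variable {m d : ℕ}

/-- The proximal mapping of `‖·‖₁ / L`: `argmin_u ‖u‖₁ + (L/2) ‖u - v‖²`. -/
def proxL1 (L : ℝ) (v : Vec d) : Vec d :=
  argminOn Set.univ fun u => l1Norm u + L / 2 * ‖u - v‖ ^ 2

/-- `τ_0 = 1`, `τ_{s+1} = (1 + √(1 + 4 τ_s²)) / 2`. -/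
def nagTau : ℕ → ℝ
  | 0 => 1
  | s + 1 => (1 + Real.sqrt (1 + 4 * nagTau s ^ 2)) / 2

/-- State of the inner loop: the iterates `x_s`, `y_s`, and the number of updates done so far. -/
structure InnerState (d : ℕ) where
  x : Vec d
  y : Vec d
  iters : ℕ

/-- One accelerated proximal gradient update on `‖·‖₁ + h_γ` with step `1 / L`:
`x_{s+1} = prox_{‖·‖₁/L}(y_s - ∇h_γ(y_s) / L)` and
`y_{s+1} = x_{s+1} + β_{s+1} (x_{s+1} - x_s)`, where `β_{s+1} = (τ_s - 1) / τ_{s+1}`. -/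
def innerStep (A : Matrix (Fin m) (Fin d) ℝ) (y : Vec m) (τ lam γ L : ℝ) (s : ℕ)
    (st : InnerState d) : InnerState d :=
  let x' := proxL1 L (st.y - (1 / L) • gradient (penalty A y τ lam γ) st.y)
  { x := x'
    y := x' + ((nagTau s - 1) / nagTau (s + 1)) • (x' - st.x)
    iters := st.iters + 1 }

/-- The inner loop, started at `x_0 = y_0 = z`. -/
def innerLoop (A : Matrix (Fin m) (Fin d) ℝ) (y : Vec m) (τ lam γ L : ℝ) (z : Vec d) :
    ℕ → InnerState d
  | 0 => { x := z, y := z, iters := 0 }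
  | s + 1 => innerStep A y τ lam γ L s (innerLoop A y τ lam γ L z s)

/-- State of the outer loop: the current point, and the numbers of gradient updates and of
projections onto `Ω` performed so far. -/
structure OuterState (d : ℕ) where
  point : Vec d
  iters : ℕ
  projs : ℕ

/-- One epoch: `t` inner updates followed by one projection. -/
def epoch (A : Matrix (Fin m) (Fin d) ℝ) (y : Vec m) (τ lam γ L : ℝ) (t : ℕ)
    (st : OuterState d) : OuterState d :=
  let r := innerLoop A y τ lam γ L st.point t
  { point := proj A y τ r.x
    iters := st.iters + r.iters
    projs := st.projs + 1 }

/-- LoPNAG (proximal form) after a given number of epochs. The `(k+1)`-st epoch uses the smoothing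
parameter `γ₁ / 2^k`, the smoothness parameter `L (γ₁ / 2^k)`, and `t k` inner updates. -/
def loPNAG (A : Matrix (Fin m) (Fin d) ℝ) (y : Vec m) (τ lam : ℝ) (L : ℝ → ℝ) (γ₁ : ℝ)
    (t : ℕ → ℕ) (x₀ : Vec d) : ℕ → OuterState d
  | 0 => { point := x₀, iters := 0, projs := 0 }
  | k + 1 => epoch A y τ lam (γ₁ / 2 ^ k) (L (γ₁ / 2 ^ k)) (t k) (loPNAG A y τ lam L γ₁ t x₀ k)

/-- The smoothness parameter `λ L_c + λ² G_c² / (4γ)` of `h_γ`. -/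
def smoothParam (lam Lc Gc γ : ℝ) : ℝ := lam * Lc + lam ^ 2 * Gc ^ 2 / (4 * γ)

/-- `p = λρ / (λρ - G)`, where `G = √d` is the Lipschitz constant of `‖·‖₁` on `ℝᵈ`. -/
def gainFactor (d : ℕ) (lam ρ : ℝ) : ℝ := lam * ρ / (lam * ρ - Real.sqrt d)

/-- `γ₁ = ε₀ / (6 p ln 2)`. -/
def initGamma (p ε₀ : ℝ) : ℝ := ε₀ / (6 * p * Real.log 2)

/-- `K = ⌈log₂(ε₀/ε)⌉`. -/
def numEpochs (ε₀ ε : ℝ) : ℕ := ⌈Real.logb 2 (ε₀ / ε)⌉₊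

/-- The length of the `(k+1)`-st epoch,
`⌈σ ε^{-1/2} max{λ G_c p √(18 ln 2), √(12 p λ L_c ε₀ / 2^k)}⌉`. -/
def epochLength (lam Lc Gc p σ ε₀ ε : ℝ) (k : ℕ) : ℕ :=
  ⌈σ / Real.sqrt ε * max (lam * Gc * p * Real.sqrt (18 * Real.log 2))
    (Real.sqrt (12 * p * (lam * Lc) * (ε₀ / 2 ^ k)))⌉₊

end Algorithm

end CompressiveSensing

end

/-! Error bound. The constraint sees `x` only through `A x`. Fix an optimal `x₀`: every `z` with `A
z = A x₀` and `‖z‖₁ ≤ ‖x₀‖₁` is optimal, and these `z` form a polyhedron. Hoffman's bound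
(`hoffman_l1Ball`) therefore controls the distance to the optimal set linearly by `‖A (x - x₀)‖` and
the objective gap. The square root comes from the first term: the midpoint of `x` and `x₀` has slack
`‖A (x - x₀)‖² / 4` at least, and this slack can be spent on shrinking the midpoint towards `0`,
which lowers the objective. Since `0` is not optimal, `c(0) > 0` and `f_* > 0`, so the gain is
quantitative (`quadratic_growth`).

Complexity. Because `λρ > √d`, the increase of `‖·‖₁` caused by projecting is at most `λ[c]₊`, hence
at most the penalty; on `Ω` the penalty is at most `γ ln 2`. An epoch thus inherits the accelerated
rate for `‖·‖₁ + h_γ` up to `γ ln 2` (`epoch_spec`). The comparison point is the nearest point of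
the `ε`-sublevel set, which the error bound places within `σ δ / √ε` when the gap is at most `ε + δ`
(`exists_mem_sublevelSet_near`). Distance is thus proportional to `δ`, and an epoch of length of
order `1 / √ε` halves `δ` (`epoch_error_le`). The invariant is `f(x_k) - f_* ≤ ε + ε₀ / 2^k`
(`loPNAG_spec`). -/

namespace CompressiveSensing

open Filter Topology

/-! ### Convexity, minimizers, projection and the proximal map -/

section Basics

variable {m d : ℕ}

/-- The continuous linear map `x ↦ A x` between Euclidean spaces. -/
noncomputable def opA (A : Matrix (Fin m) (Fin d) ℝ) : Vec d →L[ℝ] Vec m :=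
  (Matrix.toEuclideanLin A).toContinuousLinearMap

theorem constr_eq (A : Matrix (Fin m) (Fin d) ℝ) (y : Vec m) (τ : ℝ) (x : Vec d) :
    constr A y τ x = ‖opA A x - y‖ ^ 2 - τ := rfl

theorem l1Norm_nonneg (x : Vec d) : 0 ≤ l1Norm x := Finset.sum_nonneg fun _ _ => abs_nonneg _

theorem l1Norm_zero : l1Norm (0 : Vec d) = 0 := by simp [l1Norm]

theorem l1Norm_add_le (x z : Vec d) : l1Norm (x + z) ≤ l1Norm x + l1Norm z := by
  unfold l1Norm
  rw [← Finset.sum_add_distrib]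
  exact Finset.sum_le_sum fun i _ => abs_add_le _ _

theorem l1Norm_smul (a : ℝ) (x : Vec d) : l1Norm (a • x) = |a| * l1Norm x := by
  simp [l1Norm, Finset.mul_sum, abs_mul]

theorem convexOn_l1Norm : ConvexOn ℝ Set.univ (l1Norm : Vec d → ℝ) := by
  refine ⟨convex_univ, fun x _ z _ a b ha hb _ => ?_⟩
  refine (l1Norm_add_le _ _).trans ?_
  rw [l1Norm_smul, l1Norm_smul, abs_of_nonneg ha, abs_of_nonneg hb, smul_eq_mul, smul_eq_mul]

theorem continuous_l1Norm : Continuous (l1Norm : Vec d → ℝ) := by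
  unfold l1Norm
  fun_prop

theorem norm_le_l1Norm (x : Vec d) : ‖x‖ ≤ l1Norm x := by
  rw [EuclideanSpace.norm_eq, Real.sqrt_le_left (l1Norm_nonneg x)]
  simpa [l1Norm] using
    Finset.sum_sq_le_sq_sum_of_nonneg (s := Finset.univ) (f := fun i => |x i|)
      fun i _ => abs_nonneg _

theorem l1Norm_le_sqrt_mul_norm (x : Vec d) : l1Norm x ≤ Real.sqrt d * ‖x‖ := by
  rw [EuclideanSpace.norm_eq, ← Real.sqrt_mul (Nat.cast_nonneg d)]
  apply Real.le_sqrt_of_sq_le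
  simpa [l1Norm] using sq_sum_le_card_mul_sum_sq (s := Finset.univ) (f := fun i => |x i|)

theorem l1Norm_sub_le (x z : Vec d) : l1Norm x - l1Norm z ≤ Real.sqrt d * ‖x - z‖ := by
  have h := l1Norm_add_le (x - z) z
  rw [sub_add_cancel] at h
  linarith [l1Norm_le_sqrt_mul_norm (x - z)]

theorem l1Norm_eq_zero {x : Vec d} (h : l1Norm x = 0) : x = 0 :=
  norm_le_zero_iff.mp ((norm_le_l1Norm x).trans h.le)

variable (A : Matrix (Fin m) (Fin d) ℝ) (y : Vec m) (τ : ℝ)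

theorem continuous_constr : Continuous (constr A y τ) := by
  have : constr A y τ = fun x => ‖opA A x - y‖ ^ 2 - τ := rfl
  rw [this]
  fun_prop

/-- The exact remainder, not just convexity, is kept because `quadratic_growth` turns it into slack
at a midpoint. -/
theorem constr_segment (x z : Vec d) (s : ℝ) :
    constr A y τ ((1 - s) • x + s • z) = (1 - s) * constr A y τ x + s * constr A y τ z
      - s * (1 - s) * ‖opA A (x - z)‖ ^ 2 := by
  simp only [constr_eq, map_add, map_smul, map_sub]
  set a := opA A x
  set b := opA A z
  have h1 : (1 - s) • a + s • b - y = (1 - s) • (a - y) + s • (b - y) := by module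
  have h2 : a - b = (a - y) - (b - y) := by module
  rw [h1, h2]
  generalize a - y = p
  generalize b - y = q
  rw [norm_add_sq_real, norm_sub_sq_real, norm_smul, norm_smul, mul_pow, mul_pow,
    Real.norm_eq_abs, Real.norm_eq_abs, sq_abs, sq_abs, real_inner_smul_left,
    real_inner_smul_right]
  ring

theorem constr_segment_le (x z : Vec d) {s : ℝ} (h0 : 0 ≤ s) (h1 : s ≤ 1) :
    constr A y τ ((1 - s) • x + s • z) ≤ (1 - s) * constr A y τ x + s * constr A y τ z := by
  rw [constr_segment]
  have := mul_nonneg (mul_nonneg h0 (sub_nonneg.2 h1)) (sq_nonneg ‖opA A (x - z)‖)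
  linarith

theorem l1Norm_segment_le (x z : Vec d) {s : ℝ} (h0 : 0 ≤ s) (h1 : s ≤ 1) :
    l1Norm ((1 - s) • x + s • z) ≤ (1 - s) * l1Norm x + s * l1Norm z :=
  convexOn_l1Norm.2 (Set.mem_univ x) (Set.mem_univ z) (sub_nonneg.2 h1) h0 (by ring)

theorem isClosed_feasibleSet : IsClosed (feasibleSet A y τ) :=
  isClosed_le (continuous_constr A y τ) continuous_const

variable {A y τ}

theorem optVal_le {x : Vec d} (hx : x ∈ feasibleSet A y τ) : optVal A y τ ≤ l1Norm x :=
  csInf_le ⟨0, by rintro _ ⟨z, _, rfl⟩; exact l1Norm_nonneg z⟩ ⟨x, hx, rfl⟩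

theorem optSet_nonempty (h : (feasibleSet A y τ).Nonempty) : (optSet A y τ).Nonempty := by
  obtain ⟨x₀, hx₀⟩ := h
  have hco : Tendsto (l1Norm : Vec d → ℝ) (cocompact _) atTop :=
    tendsto_atTop_mono norm_le_l1Norm tendsto_norm_cocompact_atTop
  obtain ⟨x, hx, hmin⟩ := (continuous_l1Norm (d := d)).continuousOn.exists_isMinOn'
    (isClosed_feasibleSet A y τ) hx₀
    ((hco.eventually_ge_atTop (l1Norm x₀)).filter_mono inf_le_left)
  exact ⟨x, hx, fun u hu => hmin hu⟩

theorem l1Norm_eq_optVal {x : Vec d} (hx : x ∈ optSet A y τ) : l1Norm x = optVal A y τ := by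
  refine le_antisymm (le_csInf ⟨_, x, hx.1, rfl⟩ ?_) (optVal_le hx.1)
  rintro _ ⟨u, hu, rfl⟩
  exact hx.2 u hu

theorem mem_optSet_iff {x : Vec d} :
    x ∈ optSet A y τ ↔ x ∈ feasibleSet A y τ ∧ l1Norm x ≤ optVal A y τ :=
  ⟨fun hx => ⟨hx.1, (l1Norm_eq_optVal hx).le⟩,
    fun hx => ⟨hx.1, fun _ hu => hx.2.trans (optVal_le hu)⟩⟩

theorem isClosed_optSet : IsClosed (optSet A y τ) := by
  have : optSet A y τ = feasibleSet A y τ ∩ {x | l1Norm x ≤ optVal A y τ} := by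
    ext x
    exact mem_optSet_iff
  rw [this]
  exact (isClosed_feasibleSet A y τ).inter (isClosed_le continuous_l1Norm continuous_const)

theorem isClosed_sublevelSet (ε : ℝ) : IsClosed (sublevelSet A y τ ε) :=
  (isClosed_feasibleSet A y τ).inter (isClosed_le continuous_l1Norm continuous_const)

theorem argminOn_spec {E : Type*} [Nonempty E] {S : Set E} {g : E → ℝ}
    (h : ∃ u ∈ S, ∀ v ∈ S, g u ≤ g v) :
    argminOn S g ∈ S ∧ ∀ v ∈ S, g (argminOn S g) ≤ g v :=
  Classical.epsilon_spec (p := fun u => u ∈ S ∧ ∀ v ∈ S, g u ≤ g v) h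

theorem proj_spec (h : (feasibleSet A y τ).Nonempty) (x : Vec d) :
    proj A y τ x ∈ feasibleSet A y τ ∧
      ∀ v ∈ feasibleSet A y τ, ‖proj A y τ x - x‖ ≤ ‖v - x‖ := by
  obtain ⟨u, hu, hux⟩ := (isClosed_feasibleSet A y τ).exists_infDist_eq_dist h x
  have := argminOn_spec (S := feasibleSet A y τ) (g := fun u => ‖u - x‖ ^ 2) ⟨u, hu, fun v hv => by
    have h1 := Metric.infDist_le_dist_of_mem (x := x) hv
    rw [hux, dist_comm, dist_eq_norm, dist_comm, dist_eq_norm] at h1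
    exact pow_le_pow_left₀ (norm_nonneg _) h1 2⟩
  exact ⟨this.1, fun v hv => le_of_sq_le_sq (this.2 v hv) (norm_nonneg _)⟩

theorem proxL1_isMin {L : ℝ} (hL : 0 < L) (v u : Vec d) :
    l1Norm (proxL1 L v) + L / 2 * ‖proxL1 L v - v‖ ^ 2 ≤ l1Norm u + L / 2 * ‖u - v‖ ^ 2 := by
  refine (argminOn_spec (S := Set.univ) (g := fun u => l1Norm u + L / 2 * ‖u - v‖ ^ 2) ?_).2 u
    (Set.mem_univ u)
  have hc : Continuous fun u : Vec d => l1Norm u + L / 2 * ‖u - v‖ ^ 2 :=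
    continuous_l1Norm.add (by fun_prop)
  have hco : Tendsto (fun u : Vec d => l1Norm u + L / 2 * ‖u - v‖ ^ 2) (cocompact _) atTop :=
    tendsto_atTop_mono (fun u => (norm_le_l1Norm u).trans
      (le_add_of_nonneg_right (by positivity))) tendsto_norm_cocompact_atTop
  obtain ⟨w, hw⟩ := hc.exists_forall_le hco
  exact ⟨w, Set.mem_univ w, fun v _ => hw v⟩

/-- The variational inequality that characterises the proximal point. -/
theorem proxL1_variational {L : ℝ} (hL : 0 < L) (v u : Vec d) :
    l1Norm (proxL1 L v) ≤ l1Norm u + L * inner ℝ (proxL1 L v - v) (u - proxL1 L v) := by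
  set w := proxL1 L v with hw
  -- Minimality is tested against points of the segment from `w` to `u`; after division by `t`, the
  -- quadratic term vanishes as `t → 0`.
  have key : ∀ t ∈ Set.Ioc (0 : ℝ) 1, l1Norm w ≤ l1Norm u + L * inner ℝ (w - v) (u - w)
      + t * (L / 2 * ‖u - w‖ ^ 2) := by
    rintro t ⟨h0, h1⟩
    have hmin := proxL1_isMin hL v ((1 - t) • w + t • u)
    rw [← hw] at hmin
    have hcv := l1Norm_segment_le w u h0.le h1
    have e : (1 - t) • w + t • u - v = (w - v) + t • (u - w) := by module
    rw [e, norm_add_sq_real, norm_smul, mul_pow, Real.norm_eq_abs, sq_abs,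
      real_inner_smul_right] at hmin
    have : t * l1Norm w ≤ t * (l1Norm u + L * inner ℝ (w - v) (u - w)
      + t * (L / 2 * ‖u - w‖ ^ 2)) := by nlinarith
    exact le_of_mul_le_mul_left this h0
  have hlim : Tendsto (fun t : ℝ => l1Norm u + L * inner ℝ (w - v) (u - w)
      + t * (L / 2 * ‖u - w‖ ^ 2)) (𝓝[>] 0) (𝓝 (l1Norm u + L * inner ℝ (w - v) (u - w)
      + 0 * (L / 2 * ‖u - w‖ ^ 2))) := by
    refine Tendsto.mono_left (Continuous.tendsto ?_ 0) nhdsWithin_le_nhds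
    fun_prop
  have := ge_of_tendsto hlim (eventually_of_mem (Ioc_mem_nhdsGT one_pos) key)
  simpa using this

end Basics

/-! ### Hoffman's bound by sign patterns -/

section ErrorBound

variable {ι : Type*}

/-- The closed cone of vectors with signs prescribed by `s`. -/
def signCone (s : ι → SignType) : Set (ι → ℝ) := {u | ∀ i, u i = (s i : ℝ) * |u i|}

theorem isClosed_signCone (s : ι → SignType) : IsClosed (signCone s) := by
  simp only [signCone, Set.ofPred_forall]
  exact isClosed_iInter fun i => isClosed_eq (by fun_prop) (by fun_prop)

theorem smul_mem_signCone {s : ι → SignType} {u : ι → ℝ} (hu : u ∈ signCone s) {t : ℝ}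
    (ht : 0 ≤ t) : t • u ∈ signCone s := fun i => by
  have := hu i
  simp only [Pi.smul_apply, smul_eq_mul, abs_mul, abs_of_nonneg ht]
  rw [mul_left_comm, ← this]

variable {F : Type*} [Fintype ι] [NormedAddCommGroup F] [NormedSpace ℝ F]

/-- A linear map that is injective at the origin of a sign cone is bounded below on it. -/
theorem exists_norm_le_of_signCone (B : (ι → ℝ) →ₗ[ℝ] F) (s : ι → SignType)
    (h : ∀ u ∈ signCone s, B u = 0 → u = 0) :
    ∃ κ : ℝ, 0 ≤ κ ∧ ∀ u ∈ signCone s, ‖u‖ ≤ κ * ‖B u‖ := by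
  have hB : Continuous B := B.continuous_of_finiteDimensional
  have hK : IsCompact (Metric.sphere (0 : ι → ℝ) 1 ∩ signCone s) :=
    (isCompact_sphere _ _).inter_right (isClosed_signCone s)
  rcases (Metric.sphere (0 : ι → ℝ) 1 ∩ signCone s).eq_empty_or_nonempty with he | hne
  · refine ⟨0, le_rfl, fun u hu => ?_⟩
    by_contra hcon
    have hpos : 0 < ‖u‖ := by simpa using hcon
    have : ‖u‖⁻¹ • u ∈ Metric.sphere (0 : ι → ℝ) 1 ∩ signCone s :=
      ⟨by simp [norm_smul, hpos.ne'], smul_mem_signCone hu (by positivity)⟩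
    rw [he] at this
    exact this
  · obtain ⟨w, hw, hmin⟩ := hK.exists_isMinOn hne (f := fun u => ‖B u‖) (by fun_prop)
    have hw0 : 0 < ‖B w‖ := by
      rw [norm_pos_iff]
      intro h0
      have := h w hw.2 h0
      have h1 := hw.1
      rw [this] at h1
      simp at h1
    refine ⟨‖B w‖⁻¹, by positivity, fun u hu => ?_⟩
    rcases eq_or_ne u 0 with rfl | hne
    · simp
    have hpos : 0 < ‖u‖ := norm_pos_iff.2 hne
    have h1 : ‖B w‖ ≤ ‖B (‖u‖⁻¹ • u)‖ := hmin (a := ‖u‖⁻¹ • u)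
      ⟨by simp [norm_smul, hpos.ne'], smul_mem_signCone hu (by positivity)⟩
    rw [map_smul, norm_smul, norm_inv, norm_norm] at h1
    rw [inv_mul_eq_div, le_div_iff₀ hw0]
    rwa [inv_mul_eq_div, le_div_iff₀ hpos, mul_comm] at h1

/-- Hoffman's bound for polyhedra in standard form. -/
theorem hoffman_standard_form (B : (ι → ℝ) →ₗ[ℝ] F) :
    ∃ κ : ℝ, 0 ≤ κ ∧ ∀ μ ν₀ : ι → ℝ, 0 ≤ μ → 0 ≤ ν₀ →
      ∃ ν : ι → ℝ, 0 ≤ ν ∧ B ν = B ν₀ ∧ ‖ν - μ‖ ≤ κ * ‖B ν₀ - B μ‖ := by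
  classical
  have hB : Continuous B := B.continuous_of_finiteDimensional
  -- There are finitely many sign patterns, so the sum of their constants serves all of them;
  -- patterns on which `B` kills a nonzero vector get the harmless value `0`.
  have H : ∀ s : ι → SignType, ∃ κ : ℝ, 0 ≤ κ ∧ ((∀ u ∈ signCone s, B u = 0 → u = 0) →
      ∀ u ∈ signCone s, ‖u‖ ≤ κ * ‖B u‖) := fun s => by
    by_cases h : ∀ u ∈ signCone s, B u = 0 → u = 0
    · obtain ⟨κ, h0, h1⟩ := exists_norm_le_of_signCone B s h
      exact ⟨κ, h0, fun _ => h1⟩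
    · exact ⟨0, le_rfl, fun h' => absurd h' h⟩
  choose κ hκ0 hκ using H
  refine ⟨∑ s, κ s, Finset.sum_nonneg fun s _ => hκ0 s, fun μ ν₀ hμ hν₀ => ?_⟩
  set w := ν₀ - μ with hw
  set s : ι → SignType := fun i => SignType.sign (w i) with hs
  -- The candidate corrections lie coordinatewise between `0` and `w`, so adding one to `μ` stays
  -- between `μ` and `ν₀` and remains nonnegative.
  set K : Set (ι → ℝ) := {u | (u ∈ signCone s ∧ ∀ i, |u i| ≤ |w i|) ∧ B u = B w} with hK
  have hKc : IsCompact K := by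
    have hcl : IsClosed K := by
      have hbox : IsClosed {u : ι → ℝ | ∀ i, |u i| ≤ |w i|} := by
        simp only [Set.ofPred_forall]
        exact isClosed_iInter fun i => isClosed_le (by fun_prop) continuous_const
      exact ((isClosed_signCone s).inter hbox).inter (isClosed_eq hB continuous_const)
    refine Metric.isCompact_of_isClosed_isBounded hcl
      ((Metric.isBounded_closedBall (x := (0 : ι → ℝ)) (r := ‖w‖)).subset fun u hu => ?_)
    rw [mem_closedBall_zero_iff]
    exact (pi_norm_le_iff_of_nonneg (norm_nonneg _)).2 fun i => (hu.1.2 i).trans (norm_le_pi_norm w i)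
  have hwK : w ∈ K := ⟨⟨fun i => (sign_mul_abs (w i)).symm, fun i => le_rfl⟩, rfl⟩
  obtain ⟨v, hv, hmin⟩ := hKc.exists_isMinOn ⟨w, hwK⟩ (f := fun u => ∑ i, |u i|)
    (by fun_prop)
  have hvs : v ∈ signCone fun i => SignType.sign (v i) := fun i => (sign_mul_abs (v i)).symm
  -- A nonzero kernel vector with the signs of `v` could be subtracted in a small multiple, staying
  -- in `K` and lowering the ℓ¹ norm, against the choice of `v`. The cone is that of `v`, not of
  -- `w`: coordinates where `v` vanishes are forced to be zero.
  have hinj : ∀ u ∈ signCone (fun i => SignType.sign (v i)), B u = 0 → u = 0 := by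
    intro u hu hBu
    by_contra hne
    obtain ⟨t, ht, hdom⟩ : ∃ t : ℝ, 0 < t ∧ ∀ i, t * |u i| ≤ |v i| := by
      have : ∀ᶠ t : ℝ in 𝓝[>] 0, ∀ i, t * |u i| ≤ |v i| := by
        refine eventually_all.2 fun i => ?_
        rcases eq_or_ne (v i) 0 with h0 | h0
        · have : u i = 0 := by simpa [h0] using hu i
          simp [this]
        · have hc : Tendsto (fun t : ℝ => t * |u i|) (𝓝[>] 0) (𝓝 (0 * |u i|)) :=
            Tendsto.mono_left (Continuous.tendsto (by fun_prop) 0) nhdsWithin_le_nhds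
          rw [zero_mul] at hc
          exact (hc.eventually_lt_const (abs_pos.2 h0)).mono fun t ht => ht.le
      obtain ⟨t, h1, h2⟩ := (this.and self_mem_nhdsWithin).exists
      exact ⟨t, h2, h1⟩
    have habs : ∀ i, |v i - t * u i| = |v i| - t * |u i| ∧
        v i - t * u i = SignType.sign (v i) * (|v i| - t * |u i|) := by
      intro i
      have h1 := hvs i
      have h2 := hu i
      have h3 := hdom i
      have e : v i - t * u i = SignType.sign (v i) * (|v i| - t * |u i|) := by
        calc v i - t * u i = SignType.sign (v i) * |v i| - t * (SignType.sign (v i) * |u i|) := by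
              rw [← h1, ← h2]
          _ = _ := by ring
      refine ⟨?_, e⟩
      rw [e, abs_mul, abs_of_nonneg (sub_nonneg.2 h3)]
      rcases eq_or_ne (v i) 0 with h0 | h0
      · have : u i = 0 := by simpa [h0] using h2
        simp [h0, this]
      · rcases lt_or_gt_of_ne h0 with h | h <;> simp [h]
    have hmem : v - t • u ∈ K := by
      refine ⟨⟨fun i => ?_, fun i => ?_⟩, ?_⟩
      · obtain ⟨ha, he⟩ := habs i
        simp only [Pi.sub_apply, Pi.smul_apply, smul_eq_mul]
        rcases eq_or_ne (v i) 0 with h0 | h0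
        · have : u i = 0 := by simpa [h0] using hu i
          simp [h0, this]
        · have h1 : s i = SignType.sign (v i) := by
            have h2 := hv.1.1 i
            have h3 := hv.1.2 i
            have hw0 : w i ≠ 0 := fun h => h0 (by simpa [h] using h3)
            have hvp := abs_pos.2 h0
            simp only [hs] at h2 ⊢
            rcases lt_or_gt_of_ne hw0 with h | h
            · rw [sign_neg h] at h2 ⊢
              have : v i < 0 := by
                rw [h2]
                simpa using hvp
              rw [sign_neg this]
            · rw [sign_pos h] at h2 ⊢
              have : 0 < v i := by
                rw [h2]
                simpa using hvp
              rw [sign_pos this]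
          rw [h1, ha, ← he]
      · simp only [Pi.sub_apply, Pi.smul_apply, smul_eq_mul]
        rw [(habs i).1]
        have := mul_nonneg ht.le (abs_nonneg (u i))
        linarith [hv.1.2 i]
      · rw [map_sub, map_smul, hBu, smul_zero, sub_zero, hv.2]
    have h1 : ∑ i, |v i| ≤ ∑ i, |(v - t • u) i| := hmin hmem
    simp only [Pi.sub_apply, Pi.smul_apply, smul_eq_mul, (habs _).1, Finset.sum_sub_distrib,
      ← Finset.mul_sum] at h1
    obtain ⟨j, hj⟩ := Function.ne_iff.1 hne
    have : 0 < ∑ i, |u i| :=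
      Finset.sum_pos' (fun i _ => abs_nonneg _) ⟨j, Finset.mem_univ j, abs_pos.2 hj⟩
    nlinarith
  refine ⟨μ + v, fun i => ?_, ?_, ?_⟩
  · have h1 := hv.1.1 i
    have h2 := hv.1.2 i
    have h3 := hμ i
    have h4 := hν₀ i
    have h5 : w i = ν₀ i - μ i := rfl
    simp only [Pi.zero_apply, Pi.add_apply] at *
    by_contra hcon
    have hv0 : v i < 0 := by linarith
    rw [abs_of_neg hv0] at h1 h2
    have hw0 : w i < 0 := by
      by_contra hw0
      rcases (not_lt.1 hw0).eq_or_lt with h | h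
      · rw [← h, abs_zero] at h2
        linarith
      · simp only [hs] at h1
        rw [sign_pos h] at h1
        simp at h1
        linarith
    rw [abs_of_neg hw0] at h2
    linarith
  · rw [map_add, hv.2, hw, map_sub]
    abel
  · rw [add_sub_cancel_left, ← map_sub, ← hw, ← hv.2]
    refine (hκ _ hinj v hvs).trans (mul_le_mul_of_nonneg_right ?_ (norm_nonneg _))
    exact Finset.single_le_sum (f := κ) (fun s _ => hκ0 s) (Finset.mem_univ _)

end ErrorBound

/-! ### The local error bound with exponent 1/2 -/

section ErrorBound

variable {m d : ℕ} {A : Matrix (Fin m) (Fin d) ℝ} {y : Vec m} {τ : ℝ}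

/-- Hoffman's bound for the polyhedra `{x | ‖x‖₁ ≤ ‖x₀‖₁, A x = A x₀}`. -/
theorem hoffman_l1Ball (A : Matrix (Fin m) (Fin d) ℝ) :
    ∃ κ : ℝ, 0 ≤ κ ∧ ∀ x x₀ : Vec d, ∃ z : Vec d, opA A z = opA A x₀ ∧ l1Norm z ≤ l1Norm x₀ ∧
      ‖x - z‖ ≤ κ * (‖opA A (x - x₀)‖ + |l1Norm x - l1Norm x₀|) := by
  -- Splitting into positive and negative parts makes the ℓ¹ norm the linear functional `S` on the
  -- nonnegative orthant. The point returned by Hoffman's bound need not have disjoint parts, so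
  -- only `‖D ν‖₁ ≤ S ν` survives, which is enough.
  let D : (Fin d ⊕ Fin d → ℝ) →ₗ[ℝ] Vec d :=
    { toFun := fun ν => WithLp.toLp 2 fun i => ν (Sum.inl i) - ν (Sum.inr i)
      map_add' := fun a b => by
        ext i
        simp only [Pi.add_apply, PiLp.add_apply]
        ring
      map_smul' := fun a b => by
        ext i
        simp only [Pi.smul_apply, PiLp.smul_apply, smul_eq_mul, RingHom.id_apply]
        ring }
  let S : (Fin d ⊕ Fin d → ℝ) →ₗ[ℝ] ℝ := ∑ j, LinearMap.proj j
  have hS : ∀ ν, S ν = ∑ i, (ν (Sum.inl i) + ν (Sum.inr i)) := fun ν => by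
    simp [S, Finset.sum_add_distrib]
  let split : Vec d → (Fin d ⊕ Fin d → ℝ) := fun x => Sum.elim (fun i => (x i)⁺) fun i => (x i)⁻
  have hsplit0 : ∀ x, 0 ≤ split x := fun x j => by
    rcases j with i | i
    · exact posPart_nonneg _
    · exact negPart_nonneg _
  have hDs : ∀ x, D (split x) = x := fun x => by
    ext i
    exact posPart_sub_negPart _
  have hSs : ∀ x, S (split x) = l1Norm x := fun x => by
    rw [hS]
    exact Finset.sum_congr rfl fun i _ => posPart_add_negPart _
  obtain ⟨κ, hκ, H⟩ := hoffman_standard_form (((opA A).toLinearMap ∘ₗ D).prod S)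
  let D' : (Fin d ⊕ Fin d → ℝ) →L[ℝ] Vec d := D.toContinuousLinearMap
  refine ⟨‖D'‖ * κ, by positivity, fun x x₀ => ?_⟩
  obtain ⟨ν, hν, hBν, hle⟩ := H (split x) (split x₀) (hsplit0 x) (hsplit0 x₀)
  have hB : ∀ ν, (((opA A).toLinearMap ∘ₗ D).prod S) ν = (opA A (D ν), S ν) := fun _ => rfl
  simp only [hB, hDs, hSs, Prod.mk.injEq] at hBν hle
  refine ⟨D ν, hBν.1, ?_, ?_⟩
  · rw [← hBν.2, hS]
    refine Finset.sum_le_sum fun i _ => ?_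
    have h1 := hν (Sum.inl i)
    have h2 := hν (Sum.inr i)
    simp only [Pi.zero_apply] at h1 h2
    change |ν (Sum.inl i) - ν (Sum.inr i)| ≤ _
    rw [abs_le]
    constructor <;> linarith
  · have e : x - D ν = - D' (ν - split x) := by
      rw [map_sub]
      change x - D ν = -(D ν - D (split x))
      rw [hDs]
      abel
    rw [e, norm_neg, mul_assoc]
    refine (D'.le_opNorm _).trans (mul_le_mul_of_nonneg_left (hle.trans ?_) (norm_nonneg _))
    refine mul_le_mul_of_nonneg_left ?_ hκ
    rw [Prod.mk_sub_mk, Prod.norm_mk]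
    change max ‖opA A x₀ - opA A x‖ ‖l1Norm x₀ - l1Norm x‖ ≤ _
    rw [norm_sub_rev, ← map_sub, Real.norm_eq_abs, abs_sub_comm]
    exact max_le_add_of_nonneg (norm_nonneg _) (abs_nonneg _)

theorem constr_zero_pos (h : (feasibleSet A y τ).Nonempty) (h0 : (0 : Vec d) ∉ optSet A y τ) :
    0 < constr A y τ 0 := by
  by_contra hcon
  refine h0 (mem_optSet_iff.2 ⟨not_lt.1 hcon, ?_⟩)
  obtain ⟨x, hx⟩ := optSet_nonempty h
  rw [← l1Norm_eq_optVal hx, l1Norm_zero]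
  exact l1Norm_nonneg x

theorem optVal_pos (h : (feasibleSet A y τ).Nonempty) (h0 : (0 : Vec d) ∉ optSet A y τ) :
    0 < optVal A y τ := by
  obtain ⟨x, hx⟩ := optSet_nonempty h
  rw [← l1Norm_eq_optVal hx]
  refine (l1Norm_nonneg x).lt_of_ne fun h1 => h0 ?_
  rwa [← l1Norm_eq_zero h1.symm]

/-- Quadratic growth of the objective in `A x` over the feasible set. -/
theorem quadratic_growth (h : (feasibleSet A y τ).Nonempty) (h0 : (0 : Vec d) ∉ optSet A y τ)
    {x z : Vec d} (hx : x ∈ feasibleSet A y τ) (hz : z ∈ optSet A y τ) :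
    optVal A y τ * ‖opA A (x - z)‖ ^ 2 ≤ 2 * ‖y‖ ^ 2 * (l1Norm x - optVal A y τ) := by
  have hc0 := constr_zero_pos h h0
  have hf := optVal_pos h h0
  set f := optVal A y τ
  -- The midpoint has slack `a ≥ q / 4`, and its objective exceeds `f` by at most half the gap of
  -- `x`.
  set w : Vec d := (1 - 1 / 2 : ℝ) • x + (1 / 2 : ℝ) • z with hw
  have hcw := constr_segment A y τ x z (1 / 2)
  have hfw := l1Norm_segment_le x z (s := 1 / 2) (by norm_num) (by norm_num)
  rw [← hw] at hcw hfw
  rw [l1Norm_eq_optVal hz] at hfw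
  have hcx : constr A y τ x ≤ 0 := hx
  have hcz : constr A y τ z ≤ 0 := hz.1
  set q := ‖opA A (x - z)‖ ^ 2
  have hq : 0 ≤ q := sq_nonneg _
  have hcw' : q / 4 ≤ - constr A y τ w := by rw [hcw]; linarith
  set a := - constr A y τ w
  have ha : 0 ≤ a := by linarith
  have hden : 0 < constr A y τ 0 + a := by linarith
  have hye : constr A y τ 0 + a ≤ ‖y‖ ^ 2 := by
    have h1 : constr A y τ w = ‖opA A w - y‖ ^ 2 - τ := rfl
    have h2 : constr A y τ 0 = ‖y‖ ^ 2 - τ := by rw [constr_eq]; simp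
    have := sq_nonneg ‖opA A w - y‖
    simp only [a]
    linarith
  -- The fraction of the way from `w` to `0` at which convexity still guarantees feasibility.
  -- Comparing objectives there bounds `f * t` by half the gap, while `a ≤ t * ‖y‖ ^ 2`.
  set t := a / (constr A y τ 0 + a) with ht
  have ht0 : 0 ≤ t := by positivity
  have ht1 : t ≤ 1 := (div_le_one hden).2 (by linarith)
  have hte : t * (constr A y τ 0 + a) = a := div_mul_cancel₀ _ hden.ne'
  have hfeas : (1 - t) • w + t • (0 : Vec d) ∈ feasibleSet A y τ := by
    refine (constr_segment_le A y τ w 0 ht0 ht1).trans ?_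
    have : constr A y τ w = -a := by simp [a]
    rw [this]
    nlinarith
  have h1 := optVal_le hfeas
  have h2 := l1Norm_segment_le w 0 ht0 ht1
  rw [l1Norm_zero] at h2
  have h3 : f ≤ (1 - t) * l1Norm w := by linarith
  have h4 : f * t ≤ (l1Norm x - f) / 2 := by
    have hw0 : f ≤ l1Norm w := by nlinarith [l1Norm_nonneg w]
    nlinarith
  have h5 : q / 4 ≤ t * ‖y‖ ^ 2 := by nlinarith
  nlinarith [mul_le_mul_of_nonneg_left h5 hf.le, mul_le_mul_of_nonneg_right h4 (sq_nonneg ‖y‖)]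

theorem exists_localErrorBound (h : (feasibleSet A y τ).Nonempty)
    (h0 : (0 : Vec d) ∉ optSet A y τ) {ε : ℝ} (hε : 0 < ε) :
    ∃ σ : ℝ, 0 < σ ∧ LocalErrorBound A y τ (1 / 2) σ ε := by
  obtain ⟨κ, hκ, H⟩ := hoffman_l1Ball A
  obtain ⟨x₀, hx₀⟩ := optSet_nonempty h
  have hf := optVal_pos h h0
  set b := Real.sqrt (2 * ‖y‖ ^ 2 / optVal A y τ)
  refine ⟨κ * (b + Real.sqrt ε) + 1, by positivity, fun x hx => ?_⟩
  obtain ⟨z, hz1, hz2, hz3⟩ := H x x₀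
  have hxf := optVal_le hx.1
  rw [l1Norm_eq_optVal hx₀] at hz2 hz3
  have hz : z ∈ optSet A y τ := by
    refine mem_optSet_iff.2 ⟨?_, hz2⟩
    change constr A y τ z ≤ 0
    rw [constr_eq, hz1]
    exact hx₀.1
  refine (Metric.infDist_le_dist_of_mem hz).trans ?_
  rw [dist_eq_norm, ← Real.sqrt_eq_rpow]
  set g := l1Norm x - optVal A y τ with hg
  have hg0 : 0 ≤ g := sub_nonneg.2 hxf
  have hgε : g ≤ ε := by linarith [hx.2]
  have h1 : ‖opA A (x - x₀)‖ ≤ b * Real.sqrt g := by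
    rw [← Real.sqrt_mul (by positivity)]
    apply Real.le_sqrt_of_sq_le
    have := quadratic_growth h h0 hx.1 hx₀
    rw [div_mul_eq_mul_div, le_div_iff₀ hf, mul_comm]
    exact this
  have h2 : |g| ≤ Real.sqrt ε * Real.sqrt g := by
    rw [abs_of_nonneg hg0]
    calc g = Real.sqrt g * Real.sqrt g := (Real.mul_self_sqrt hg0).symm
      _ ≤ _ := mul_le_mul_of_nonneg_right (Real.sqrt_le_sqrt hgε) (Real.sqrt_nonneg _)
  calc ‖x - z‖ ≤ κ * (‖opA A (x - x₀)‖ + |g|) := hz3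
    _ ≤ κ * (b * Real.sqrt g + Real.sqrt ε * Real.sqrt g) := by gcongr
    _ ≤ (κ * (b + Real.sqrt ε) + 1) * Real.sqrt g := by
      have := Real.sqrt_nonneg g
      nlinarith

end ErrorBound

/-! ### The softplus function and its derivative -/

section Softplus

theorem hasDerivAt_softplus (u : ℝ) :
    HasDerivAt (fun u => Real.log (1 + Real.exp u)) (Real.sigmoid u) u := by
  have h : (1 + Real.exp u) ≠ 0 := by positivity
  convert ((Real.hasDerivAt_exp u).const_add 1).log h using 1
  rw [Real.sigmoid_def, Real.exp_neg]
  have := (Real.exp_pos u).ne'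
  field_simp
  ring

/-- This is convexity of `exp` between `0` and `a - b` with weights `1 - sigmoid b` and `sigmoid b`,
multiplied by `1 + exp b`. -/
theorem softplus_ge_tangent (a b : ℝ) :
    Real.log (1 + Real.exp b) + Real.sigmoid b * (a - b) ≤ Real.log (1 + Real.exp a) := by
  have hs0 := Real.sigmoid_nonneg b
  have hs1 := Real.sigmoid_le_one b
  have hcv := convexOn_exp.2 (Set.mem_univ (0 : ℝ)) (Set.mem_univ (a - b)) (sub_nonneg.2 hs1) hs0
    (by ring)
  simp only [smul_eq_mul, mul_zero, zero_add, Real.exp_zero, mul_one] at hcv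
  have hb : 0 < 1 + Real.exp b := by positivity
  have e : (1 + Real.exp b) * (1 - Real.sigmoid b + Real.sigmoid b * Real.exp (a - b))
      = 1 + Real.exp a := by
    rw [Real.sigmoid_def, Real.exp_neg, Real.exp_sub]
    have := (Real.exp_pos b).ne'
    field_simp
    ring
  have h1 : Real.exp (Real.log (1 + Real.exp b) + Real.sigmoid b * (a - b)) ≤ 1 + Real.exp a := by
    rw [Real.exp_add, Real.exp_log hb, ← e]
    exact mul_le_mul_of_nonneg_left hcv hb.le
  exact (Real.le_log_iff_exp_le (by positivity)).2 h1

theorem sigmoid_mul_one_sub_le (u : ℝ) : Real.sigmoid u * (1 - Real.sigmoid u) ≤ 1 / 4 := by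
  nlinarith [sq_nonneg (Real.sigmoid u - 1 / 2)]

theorem sigmoid_mul_one_sub_nonneg (u : ℝ) : 0 ≤ Real.sigmoid u * (1 - Real.sigmoid u) :=
  mul_nonneg (Real.sigmoid_nonneg u) (sub_nonneg.2 (Real.sigmoid_le_one u))

/-- The decay of the sigmoid's derivative beats linear growth; this offsets the growth of `‖∇c‖²` in
the Hessian of the penalty. -/
theorem mul_sigmoid_mul_one_sub_le (u : ℝ) :
    u * (Real.sigmoid u * (1 - Real.sigmoid u)) ≤ 1 := by
  rcases le_or_gt u 0 with hu | hu
  · exact (mul_nonpos_of_nonpos_of_nonneg hu (sigmoid_mul_one_sub_nonneg u)).trans zero_le_one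
  · have h1 : u * (1 - Real.sigmoid u) ≤ 1 := by
      rw [← Real.sigmoid_neg, Real.sigmoid_def, neg_neg, ← div_eq_mul_inv,
        div_le_one (by positivity)]
      linarith [Real.add_one_le_exp u]
    have h2 := Real.sigmoid_le_one u
    have h3 := Real.sigmoid_nonneg u
    nlinarith

end Softplus

/-! ### Regularity of the constraint from Slater's condition -/

section Regularity

variable {m d : ℕ} {A : Matrix (Fin m) (Fin d) ℝ} {y : Vec m} {τ : ℝ}

theorem exists_preimage_norm_le (A : Matrix (Fin m) (Fin d) ℝ) :
    ∃ C : ℝ, 0 < C ∧ ∀ x : Vec d, ∃ z : Vec d, opA A z = opA A x ∧ ‖z‖ ≤ C * ‖opA A x‖ := by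
  obtain ⟨C, hC, H⟩ := (opA A).toLinearMap.rangeRestrict.toContinuousLinearMap.exists_preimage_norm_le
    (opA A).toLinearMap.surjective_rangeRestrict
  refine ⟨C, hC, fun x => ?_⟩
  obtain ⟨z, hz, hle⟩ := H ⟨opA A x, x, rfl⟩
  exact ⟨z, congrArg Subtype.val hz, hle⟩

/-- Moving from `x` straight to the Slater point may be long along the kernel of `A`, where `c` does
not change. Instead one moves to `x - z`, which has the same image as `x₀`, with `‖z‖` controlled by
`‖A (x - x₀)‖`. -/
theorem exists_constraintRegular (h : ∃ x₀ : Vec d, constr A y τ x₀ < 0) :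
    ∃ ρ : ℝ, 0 < ρ ∧ ConstraintRegular A y τ ρ := by
  obtain ⟨x₀, hx₀⟩ := h
  obtain ⟨C, hC, H⟩ := exists_preimage_norm_le A
  have hne : (feasibleSet A y τ).Nonempty := ⟨x₀, hx₀.le⟩
  set δ := - constr A y τ x₀ with hδ
  have hδ0 : 0 < δ := neg_pos.2 hx₀
  have hc₀ : ‖opA A x₀ - y‖ ^ 2 = τ - δ := by rw [hδ, constr_eq]; ring
  have hτ : 0 < τ := by nlinarith [sq_nonneg ‖opA A x₀ - y‖]
  set M := 1 + (τ + 1) / δ with hM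
  have hM0 : 0 < M := by positivity
  have hMδ : M * δ = δ + (τ + 1) := by
    rw [hM, add_mul, one_mul, div_mul_cancel₀ _ hδ0.ne']
  refine ⟨(C * M)⁻¹, by positivity, fun x => ?_⟩
  rw [div_inv_eq_mul]
  obtain ⟨-, hp⟩ := proj_spec hne x
  rcases le_or_gt (constr A y τ x) 0 with hx | hx
  · refine (hp x hx).trans ?_
    rw [sub_self, norm_zero]
    positivity
  rw [max_eq_left hx.le]
  set c := constr A y τ x with hc
  obtain ⟨z, hz, hle⟩ := H (x - x₀)
  -- Convexity between the values `c` and `-δ` makes the constraint nonpositive at this fraction.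
  set s := c / (c + δ) with hs
  have hden : 0 < c + δ := by positivity
  have hs0 : 0 ≤ s := by positivity
  have hs1 : s ≤ 1 := (div_le_one hden).2 (by linarith)
  have hse : s * (c + δ) = c := div_mul_cancel₀ _ hden.ne'
  have hcz : constr A y τ (x - z) = -δ := by
    rw [constr_eq, map_sub, hz, map_sub, sub_sub_cancel, hc₀]
    ring
  have hfeas : (1 - s) • x + s • (x - z) ∈ feasibleSet A y τ := by
    refine (constr_segment_le A y τ x (x - z) hs0 hs1).trans ?_
    rw [hcz, ← hc]
    nlinarith
  have e : (1 - s) • x + s • (x - z) - x = -(s • z) := by module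
  have h1 := hp _ hfeas
  rw [e, norm_neg, norm_smul, Real.norm_eq_abs, abs_of_nonneg hs0] at h1
  -- Each residual norm `r` satisfies `2r ≤ r² + 1`, and the squared residuals are `c + τ` and `τ -
  -- δ`; `M` is chosen to absorb the resulting constant.
  have h2 : ‖opA A (x - x₀)‖ ≤ M * (c + δ) := by
    have h3 : ‖opA A (x - x₀)‖ ≤ ‖opA A x - y‖ + ‖opA A x₀ - y‖ := by
      rw [map_sub, ← sub_sub_sub_cancel_right _ _ y]
      exact norm_sub_le _ _
    have h4 : ‖opA A x - y‖ ^ 2 = c + τ := by rw [hc, constr_eq]; ring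
    have h5 : c ≤ M * c := by
      have : 1 ≤ M := by
        have : 0 ≤ (τ + 1) / δ := by positivity
        linarith
      nlinarith
    nlinarith [sq_nonneg (‖opA A x - y‖ - 1), sq_nonneg (‖opA A x₀ - y‖ - 1)]
  calc ‖proj A y τ x - x‖ ≤ s * ‖z‖ := h1
    _ ≤ s * (C * (M * (c + δ))) := by gcongr; exact hle.trans (by gcongr)
    _ = C * M * (s * (c + δ)) := by ring
    _ = c * (C * M) := by rw [hse]; ring

end Regularity

/-! ### Gradient, bounds and smoothness of the penalty -/

section Penalty

variable {m d : ℕ} (A : Matrix (Fin m) (Fin d) ℝ) (y : Vec m) (τ : ℝ)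

/-- The gradient `2 Aᵀ (A x - y)` of the constraint function. -/
noncomputable def constrGrad (x : Vec d) : Vec d :=
  (2 : ℝ) • (opA A).adjoint (opA A x - y)

theorem inner_constrGrad (x v : Vec d) :
    inner ℝ (constrGrad A y x) v = 2 * inner ℝ (opA A x - y) (opA A v) := by
  rw [constrGrad, real_inner_smul_left, ContinuousLinearMap.adjoint_inner_left]

theorem hasGradientAt_constr (x : Vec d) :
    HasGradientAt (constr A y τ) (constrGrad A y x) x := by
  rw [hasGradientAt_iff_hasFDerivAt]
  have h := (((opA A).hasFDerivAt (x := x)).sub_const y).norm_sq.sub_const τ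
  refine h.congr_fderiv ?_
  ext v
  rw [InnerProductSpace.toDual_apply_apply, inner_constrGrad]
  simp [inner_sub_left]

theorem constr_ge_tangent (x z : Vec d) :
    constr A y τ x + inner ℝ (constrGrad A y x) (z - x) ≤ constr A y τ z := by
  rw [inner_constrGrad, constr_eq, constr_eq]
  have e : opA A z - y = (opA A x - y) + opA A (z - x) := by
    rw [map_sub]
    abel
  rw [e, norm_add_sq_real]
  nlinarith [sq_nonneg ‖opA A (z - x)‖]

theorem norm_constrGrad_sq_le (x : Vec d) :
    ‖constrGrad A y x‖ ^ 2 ≤ 4 * ‖opA A‖ ^ 2 * (constr A y τ x + τ) := by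
  have h : ‖constrGrad A y x‖ ≤ 2 * (‖opA A‖ * ‖opA A x - y‖) := by
    rw [constrGrad, norm_smul, Real.norm_ofNat]
    have := (opA A).adjoint.le_opNorm (opA A x - y)
    rw [LinearIsometryEquiv.norm_map] at this
    linarith
  calc ‖constrGrad A y x‖ ^ 2 ≤ (2 * (‖opA A‖ * ‖opA A x - y‖)) ^ 2 := by gcongr
    _ = _ := by rw [constr_eq]; ring

variable {lam γ : ℝ}

/-- The gradient of the penalty function. -/
noncomputable def penaltyGrad (lam γ : ℝ) (x : Vec d) : Vec d :=
  (lam * Real.sigmoid (lam * constr A y τ x / γ)) • constrGrad A y x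

theorem hasGradientAt_penalty (hγ : 0 < γ) (x : Vec d) :
    HasGradientAt (penalty A y τ lam γ) (penaltyGrad A y τ lam γ x) x := by
  have hc := (hasGradientAt_constr A y τ x).hasFDerivAt
  rw [hasGradientAt_iff_hasFDerivAt]
  have h1 := (hc.const_mul (lam / γ))
  have h2 := (((hasDerivAt_softplus (lam / γ * constr A y τ x)).comp_hasFDerivAt x h1).const_mul γ)
  have e : ∀ z, lam / γ * constr A y τ z = lam * constr A y τ z / γ := fun z => by ring
  refine (h2.congr_fderiv ?_).congr_of_eventuallyEq (Eventually.of_forall fun z => ?_)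
  · ext v
    simp only [penaltyGrad, InnerProductSpace.toDual_apply_apply, real_inner_smul_left,
      smul_apply, smul_eq_mul, e]
    field_simp
  · simp only [penalty, Function.comp, e]

theorem gradient_penalty (hγ : 0 < γ) (x : Vec d) :
    gradient (penalty A y τ lam γ) x = penaltyGrad A y τ lam γ x :=
  (hasGradientAt_penalty A y τ hγ x).gradient

theorem penalty_ge_tangent (hlam : 0 ≤ lam) (hγ : 0 < γ) (x z : Vec d) :
    penalty A y τ lam γ x + inner ℝ (gradient (penalty A y τ lam γ) x) (z - x)
      ≤ penalty A y τ lam γ z := by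
  rw [gradient_penalty A y τ hγ, penaltyGrad, real_inner_smul_left, penalty, penalty]
  have h1 := softplus_ge_tangent (lam * constr A y τ z / γ) (lam * constr A y τ x / γ)
  have h2 := constr_ge_tangent A y τ x z
  set s := Real.sigmoid (lam * constr A y τ x / γ)
  have hs : 0 ≤ s := Real.sigmoid_nonneg _
  have h3 := mul_le_mul_of_nonneg_left h1 hγ.le
  have e : γ * (s * (lam * constr A y τ z / γ - lam * constr A y τ x / γ))
      = lam * s * (constr A y τ z - constr A y τ x) := by
    field_simp
  have h4 : lam * s * inner ℝ (constrGrad A y x) (z - x)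
      ≤ lam * s * (constr A y τ z - constr A y τ x) :=
    mul_le_mul_of_nonneg_left (by linarith) (mul_nonneg hlam hs)
  rw [mul_add, e] at h3
  linarith

theorem penalty_nonneg (hγ : 0 < γ) (x : Vec d) : 0 ≤ penalty A y τ lam γ x :=
  mul_nonneg hγ.le (Real.log_nonneg (by linarith [Real.exp_pos (lam * constr A y τ x / γ)]))

theorem mul_constr_le_penalty (hγ : 0 < γ) (x : Vec d) :
    lam * constr A y τ x ≤ penalty A y τ lam γ x := by
  have h : lam * constr A y τ x / γ ≤ Real.log (1 + Real.exp (lam * constr A y τ x / γ)) := by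
    rw [Real.le_log_iff_exp_le (by positivity)]
    linarith
  rw [div_le_iff₀ hγ] at h
  rw [penalty]
  linarith

theorem penalty_le_of_mem (hlam : 0 ≤ lam) (hγ : 0 < γ) {x : Vec d} (hx : x ∈ feasibleSet A y τ) :
    penalty A y τ lam γ x ≤ γ * Real.log 2 := by
  refine mul_le_mul_of_nonneg_left (Real.log_le_log (by positivity) ?_) hγ.le
  have : Real.exp (lam * constr A y τ x / γ) ≤ 1 :=
    Real.exp_le_one_iff.2 (div_nonpos_of_nonpos_of_nonneg
      (mul_nonpos_of_nonneg_of_nonpos hlam hx) hγ.le)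
  linarith

theorem constrGrad_hasFDerivAt (x : Vec d) :
    HasFDerivAt (constrGrad A y) ((2 : ℝ) • ((opA A).adjoint ∘L opA A)) x :=
  (((opA A).adjoint ∘L opA A).hasFDerivAt.sub_const ((opA A).adjoint y)).const_smul (2 : ℝ)
    |>.congr_of_eventuallyEq (Eventually.of_forall fun z => by simp [constrGrad])

/-- The penalty is smooth with constant `λ L_c + λ² G_c² / (4γ)`, although the gradient of the
constraint function is unbounded. -/
theorem exists_isSmooth_penalty (hτ : 0 ≤ τ) :
    ∃ Lc Gc : ℝ, 0 < Lc ∧ 0 < Gc ∧ ∀ lam γ : ℝ, 0 < lam → 0 < γ →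
      IsSmooth (penalty A y τ lam γ) (smoothParam lam Lc Gc γ) := by
  -- The 6 is 2 from the Hessian of `c` plus 4 from the part of `‖∇c‖² ≤ 4‖A‖²(c + τ)` proportional
  -- to `c`; the part with `τ` gives `Gc`. The summands 1 only ensure positivity.
  refine ⟨6 * ‖opA A‖ ^ 2 + 1, 2 * ‖opA A‖ * Real.sqrt τ + 1, by positivity, by positivity,
    fun lam γ hlam hγ => ⟨fun x => (hasGradientAt_penalty A y τ hγ x).differentiableAt,
      fun x z => ?_⟩⟩
  rw [gradient_penalty A y τ hγ, gradient_penalty A y τ hγ]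
  let u' : Vec d → (Vec d →L[ℝ] ℝ) := fun x =>
    (lam / γ) • InnerProductSpace.toDual ℝ (Vec d) (constrGrad A y x)
  let s : Vec d → ℝ := fun x => Real.sigmoid (lam / γ * constr A y τ x)
  let G' : Vec d → (Vec d →L[ℝ] Vec d) := fun x =>
    (lam * s x) • ((2 : ℝ) • ((opA A).adjoint ∘L opA A))
      + (lam • ((s x * (1 - s x)) • u' x)).smulRight (constrGrad A y x)
  have hG : ∀ x, HasFDerivAt (penaltyGrad A y τ lam γ) (G' x) x := fun x => by
    have h1 := (hasGradientAt_constr A y τ x).hasFDerivAt.const_mul (lam / γ)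
    have h2 := ((Real.hasDerivAt_sigmoid (lam / γ * constr A y τ x)).comp_hasFDerivAt x
      h1).const_mul lam
    refine (h2.smul (constrGrad_hasFDerivAt A y x)).congr_of_eventuallyEq
      (Eventually.of_forall fun z => ?_)
    simp only [penaltyGrad, Function.comp, div_mul_eq_mul_div, Pi.smul_apply']
  have hbound : ∀ x, ‖G' x‖ ≤ smoothParam lam (6 * ‖opA A‖ ^ 2 + 1)
      (2 * ‖opA A‖ * Real.sqrt τ + 1) γ := fun x => by
    have hs0 : 0 ≤ s x := Real.sigmoid_nonneg _
    have hs1 : s x ≤ 1 := Real.sigmoid_le_one _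
    have hss0 : 0 ≤ s x * (1 - s x) := sigmoid_mul_one_sub_nonneg _
    have hss1 : s x * (1 - s x) ≤ 1 / 4 := sigmoid_mul_one_sub_le _
    have hus : lam / γ * constr A y τ x * (s x * (1 - s x)) ≤ 1 := mul_sigmoid_mul_one_sub_le _
    have hTT : ‖(opA A).adjoint ∘L opA A‖ ≤ ‖opA A‖ ^ 2 := by
      refine (ContinuousLinearMap.opNorm_comp_le _ _).trans ?_
      rw [LinearIsometryEquiv.norm_map, sq]
    have h1 : ‖(lam * s x) • ((2 : ℝ) • ((opA A).adjoint ∘L opA A))‖ ≤ lam * (2 * ‖opA A‖ ^ 2) := by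
      rw [norm_smul, norm_smul, Real.norm_ofNat, Real.norm_eq_abs, abs_of_nonneg (by positivity)]
      have : lam * s x ≤ lam := by nlinarith
      gcongr
    have h2 : ‖(lam • ((s x * (1 - s x)) • u' x)).smulRight (constrGrad A y x)‖
        ≤ lam * (4 * ‖opA A‖ ^ 2) + lam ^ 2 * (4 * ‖opA A‖ ^ 2 * τ) / (4 * γ) := by
      rw [ContinuousLinearMap.norm_smulRight_apply]
      simp only [u', norm_smul, Real.norm_eq_abs, LinearIsometryEquiv.norm_map]
      rw [abs_of_pos hlam, abs_of_nonneg hss0, abs_of_pos (by positivity : 0 < lam / γ)]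
      set q := s x * (1 - s x)
      calc lam * (q * (lam / γ * ‖constrGrad A y x‖)) * ‖constrGrad A y x‖
          = lam * q * (lam / γ) * ‖constrGrad A y x‖ ^ 2 := by ring
        _ ≤ lam * q * (lam / γ) * (4 * ‖opA A‖ ^ 2 * (constr A y τ x + τ)) := by
          gcongr
          exact norm_constrGrad_sq_le A y τ x
        -- The first term is bounded by `u σ'(u) ≤ 1` with `u = λ c / γ` and `σ` the sigmoid, the
        -- second by `σ' ≤ 1 / 4`.
        _ = lam * (4 * ‖opA A‖ ^ 2) * (lam / γ * constr A y τ x * q)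
            + lam * (lam / γ) * (4 * ‖opA A‖ ^ 2) * τ * q := by ring
        _ ≤ lam * (4 * ‖opA A‖ ^ 2) * 1 + lam * (lam / γ) * (4 * ‖opA A‖ ^ 2) * τ * (1 / 4) := by
          gcongr
        _ = _ := by field_simp
    refine (norm_add_le _ _).trans ((add_le_add h1 h2).trans ?_)
    rw [smoothParam]
    have h3 : 4 * ‖opA A‖ ^ 2 * τ ≤ (2 * ‖opA A‖ * Real.sqrt τ + 1) ^ 2 := by
      have h4 : 0 ≤ 2 * ‖opA A‖ * Real.sqrt τ := by positivity
      have h5 : (2 * ‖opA A‖ * Real.sqrt τ) ^ 2 = 4 * ‖opA A‖ ^ 2 * τ := by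
        rw [mul_pow, Real.sq_sqrt hτ]
        ring
      nlinarith
    have h6 : lam ^ 2 * (4 * ‖opA A‖ ^ 2 * τ) / (4 * γ)
        ≤ lam ^ 2 * (2 * ‖opA A‖ * Real.sqrt τ + 1) ^ 2 / (4 * γ) := by gcongr
    nlinarith
  exact Convex.norm_image_sub_le_of_norm_hasFDerivWithin_le
    (fun x _ => (hG x).hasFDerivWithinAt) (fun x _ => hbound x) convex_univ
    (Set.mem_univ z) (Set.mem_univ x)

end Penalty

/-! ### Descent lemma, proximal gradient step, momentum sequence -/

section Descent

variable {d : ℕ}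

/-- The descent lemma. -/
theorem IsSmooth.descent {g : Vec d → ℝ} {L : ℝ} (h : IsSmooth g L) (x z : Vec d) :
    g z ≤ g x + inner ℝ (gradient g x) (z - x) + L / 2 * ‖z - x‖ ^ 2 := by
  set v := z - x with hv
  -- This function of `t` is antitone on `[0, 1]` by the Lipschitz bound on the gradient; its values
  -- at `0` and `1` give the claim.
  have hd : ∀ t : ℝ, HasDerivAt
      (fun t : ℝ => g (x + t • v) - t * inner ℝ (gradient g x) v - L / 2 * ‖v‖ ^ 2 * t ^ 2)
      (inner ℝ (gradient g (x + t • v)) v - 1 * inner ℝ (gradient g x) v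
        - L / 2 * ‖v‖ ^ 2 * (2 * t)) t := fun t => by
    have h1 : HasDerivAt (fun t : ℝ => x + t • v) v t := by
      simpa using ((hasDerivAt_id t).smul_const v).const_add x
    have h2 := (h.1 (x + t • v)).hasGradientAt.hasFDerivAt.comp_hasDerivAt t h1
    rw [InnerProductSpace.toDual_apply_apply] at h2
    have h3 : HasDerivAt (fun t : ℝ => t ^ 2) (2 * t) t := by simpa using hasDerivAt_pow 2 t
    exact (h2.sub ((hasDerivAt_id t).mul_const _)).sub (h3.const_mul _)
  have hanti := antitoneOn_of_deriv_nonpos (convex_Icc (0 : ℝ) 1)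
    (fun t _ => (hd t).continuousAt.continuousWithinAt)
    (fun t _ => (hd t).differentiableAt.differentiableWithinAt) (fun t ht => by
      rw [interior_Icc] at ht
      rw [(hd t).deriv, one_mul, ← inner_sub_left]
      have h1 := real_inner_le_norm (gradient g (x + t • v) - gradient g x) v
      have h2 := h.2 (x + t • v) x
      rw [add_sub_cancel_left, norm_smul, Real.norm_eq_abs, abs_of_pos ht.1] at h2
      nlinarith [norm_nonneg v])
  have := hanti (Set.left_mem_Icc.2 zero_le_one) (Set.right_mem_Icc.2 zero_le_one) zero_le_one
  simp only [one_smul, zero_smul, add_zero, hv, add_sub_cancel] at this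
  linarith

/-- One proximal gradient step on the sum of `‖·‖₁` and a smooth function lying above its
tangents. -/
theorem proxGrad_step {g : Vec d → ℝ} {L : ℝ} (hL : 0 < L) (hg : IsSmooth g L)
    (hcv : ∀ x z, g x + inner ℝ (gradient g x) (z - x) ≤ g z) (w u : Vec d) :
    l1Norm (proxL1 L (w - (1 / L) • gradient g w)) + g (proxL1 L (w - (1 / L) • gradient g w))
      ≤ l1Norm u + g u + L / 2 *
        (‖w - u‖ ^ 2 - ‖proxL1 L (w - (1 / L) • gradient g w) - u‖ ^ 2) := by
  have h1 := proxL1_variational hL (w - (1 / L) • gradient g w) u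
  set x := proxL1 L (w - (1 / L) • gradient g w)
  have h2 := hg.descent w x
  have h3 := hcv w u
  have e1 : x - (w - (1 / L) • gradient g w) = (x - w) + (1 / L) • gradient g w := by abel
  have e2 : u - w = (u - x) + (x - w) := by abel
  rw [e1, inner_add_left, real_inner_smul_left, mul_add, ← mul_assoc, mul_one_div_cancel hL.ne',
    one_mul] at h1
  rw [norm_sub_rev w u, norm_sub_rev x u, e2, norm_add_sq_real, real_inner_comm]
  rw [e2, inner_add_right] at h3
  linarith

theorem norm_extrapolation_sq (a : ℝ) (x w u : Vec d) :
    ‖a • w - (a - 1) • x - u‖ ^ 2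
      = a * (a - 1) * ‖w - x‖ ^ 2 + a * ‖w - u‖ ^ 2 - (a - 1) * ‖x - u‖ ^ 2 := by
  have e1 : a • w - (a - 1) • x - u = (a - 1) • (w - x) + (w - u) := by module
  have e2 : x - u = (w - u) - (w - x) := by abel
  rw [e1, e2]
  generalize w - x = p
  generalize w - u = q
  rw [norm_add_sq_real, norm_sub_sq_real, norm_smul, mul_pow, Real.norm_eq_abs, sq_abs,
    real_inner_smul_left, real_inner_comm p q]
  ring

theorem nagTau_ge (s : ℕ) : ((s : ℝ) + 2) / 2 ≤ nagTau s := by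
  induction s with
  | zero => simp [nagTau]
  | succ s ih =>
    have h : 2 * nagTau s ≤ Real.sqrt (1 + 4 * nagTau s ^ 2) := by
      apply Real.le_sqrt_of_sq_le
      nlinarith
    rw [nagTau]
    push_cast
    linarith

theorem nagTau_pos (s : ℕ) : 0 < nagTau s :=
  lt_of_lt_of_le (by positivity) (nagTau_ge s)

theorem one_le_nagTau (s : ℕ) : 1 ≤ nagTau s := by
  have := nagTau_ge s
  have : (0 : ℝ) ≤ s := Nat.cast_nonneg s
  linarith

theorem nagTau_succ_mul (s : ℕ) : nagTau (s + 1) * (nagTau (s + 1) - 1) = nagTau s ^ 2 := by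
  have h : Real.sqrt (1 + 4 * nagTau s ^ 2) ^ 2 = 1 + 4 * nagTau s ^ 2 :=
    Real.sq_sqrt (by positivity)
  rw [nagTau]
  linarith

end Descent

/-! ### The accelerated rate of the inner loop -/

section InnerLoop

variable {m d : ℕ} {A : Matrix (Fin m) (Fin d) ℝ} {y : Vec m} {τ lam γ L : ℝ}

theorem innerLoop_iters (z : Vec d) (t : ℕ) : (innerLoop A y τ lam γ L z t).iters = t := by
  induction t with
  | zero => rfl
  | succ t ih => exact congrArg (· + 1) ih

/-- The step inequality at the previous iterate, weighted `a(a - 1)`, is added to that at `u`,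
weighted `a`, where `a = τ_s`. The weights sum to `a² = τ_{s+1}(τ_{s+1} - 1)`, and
`norm_extrapolation_sq` makes the distance terms telescope. As `τ_0 = 1`, the initial objective has
weight zero. -/
theorem innerLoop_potential (hlam : 0 ≤ lam) (hγ : 0 < γ) (hL : 0 < L)
    (hsm : IsSmooth (penalty A y τ lam γ) L) (z u : Vec d) (t : ℕ) :
    nagTau t * (nagTau t - 1) *
        (l1Norm (innerLoop A y τ lam γ L z t).x + penalty A y τ lam γ (innerLoop A y τ lam γ L z t).x
          - (l1Norm u + penalty A y τ lam γ u))
      + L / 2 * ‖nagTau t • (innerLoop A y τ lam γ L z t).y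
          - (nagTau t - 1) • (innerLoop A y τ lam γ L z t).x - u‖ ^ 2
      ≤ L / 2 * ‖z - u‖ ^ 2 := by
  induction t with
  | zero => simp [nagTau, innerLoop]
  | succ s ih =>
    refine le_trans ?_ ih
    simp only [innerLoop, innerStep]
    generalize (innerLoop A y τ lam γ L z s).x = x
    generalize (innerLoop A y τ lam γ L z s).y = w
    have hstep := proxGrad_step hL hsm (penalty_ge_tangent A y τ hlam hγ) w
    generalize proxL1 L (w - (1 / L) • gradient (penalty A y τ lam γ) w) = x' at hstep ⊢
    have h1 := hstep x
    have h2 := hstep u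
    rw [nagTau_succ_mul]
    have hb := (nagTau_pos (s + 1)).ne'
    have ha := one_le_nagTau s
    -- The momentum coefficient is chosen exactly so that this identity holds.
    have e : nagTau (s + 1) • (x' + ((nagTau s - 1) / nagTau (s + 1)) • (x' - x))
        - (nagTau (s + 1) - 1) • x' - u = nagTau s • x' - (nagTau s - 1) • x - u := by
      rw [smul_add, smul_smul, mul_div_cancel₀ _ hb]
      module
    rw [e]
    generalize nagTau s = a at ha ⊢
    rw [norm_extrapolation_sq, norm_extrapolation_sq]
    have h3 := mul_le_mul_of_nonneg_left h1 (mul_nonneg (zero_le_one.trans ha) (sub_nonneg.2 ha))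
    have h4 := mul_le_mul_of_nonneg_left h2 (zero_le_one.trans ha)
    linarith

/-- The `O(L / t²)` rate of the accelerated proximal gradient method. -/
theorem innerLoop_rate (hlam : 0 ≤ lam) (hγ : 0 < γ) (hL : 0 < L)
    (hsm : IsSmooth (penalty A y τ lam γ) L) (z u : Vec d) {t : ℕ} (ht : 0 < t) :
    l1Norm (innerLoop A y τ lam γ L z t).x + penalty A y τ lam γ (innerLoop A y τ lam γ L z t).x
      ≤ l1Norm u + penalty A y τ lam γ u + 2 * L * ‖z - u‖ ^ 2 / (t : ℝ) ^ 2 := by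
  have h := innerLoop_potential hlam hγ hL hsm z u t
  set Δ := l1Norm (innerLoop A y τ lam γ L z t).x
    + penalty A y τ lam γ (innerLoop A y τ lam γ L z t).x
    - (l1Norm u + penalty A y τ lam γ u) with hΔ
  have hn : 0 ≤ L / 2 * ‖nagTau t • (innerLoop A y τ lam γ L z t).y
          - (nagTau t - 1) • (innerLoop A y τ lam γ L z t).x - u‖ ^ 2 := by positivity
  have ht' : (0 : ℝ) < t := Nat.cast_pos.2 ht
  suffices Δ ≤ 2 * L * ‖z - u‖ ^ 2 / (t : ℝ) ^ 2 by linarith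
  rcases le_or_gt Δ 0 with h0 | h0
  · exact h0.trans (by positivity)
  obtain ⟨s, rfl⟩ := Nat.exists_eq_succ_of_ne_zero ht.ne'
  rw [Nat.succ_eq_add_one] at *
  rw [nagTau_succ_mul] at h
  have hs : (((s + 1 : ℕ) : ℝ) / 2) ^ 2 ≤ nagTau s ^ 2 := by
    refine pow_le_pow_left₀ (by positivity) (le_trans ?_ (nagTau_ge s)) 2
    push_cast
    linarith
  rw [le_div_iff₀ (by positivity)]
  nlinarith [mul_le_mul_of_nonneg_right hs h0.le]

/-- The smoothness constant of a non-constant penalty is positive. -/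
theorem IsSmooth.penalty_pos (hlam : 0 < lam) (hγ : 0 < γ)
    (hsm : IsSmooth (penalty A y τ lam γ) L) {x z : Vec d}
    (hxz : constr A y τ x < constr A y τ z) : 0 < L := by
  by_contra hL
  have hd : ∀ w, penalty A y τ lam γ w ≤ penalty A y τ lam γ x
      + inner ℝ (gradient (penalty A y τ lam γ) x) (w - x) := fun w => by
    have h1 := hsm.descent x w
    have h2 := mul_nonneg (sub_nonneg.2 (not_lt.1 hL)) (sq_nonneg ‖w - x‖)
    linarith
  set v := gradient (penalty A y τ lam γ) x
  have hx0 := penalty_nonneg A y τ (lam := lam) hγ x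
  -- A nonnegative function lies below an affine one only if the slope is zero: the point tested
  -- below is where the affine bound equals `-1`.
  have hv : v = 0 := by
    by_contra hv
    have hv0 : 0 < ‖v‖ ^ 2 := pow_pos (norm_pos_iff.2 hv) 2
    have h1 := hd (x - ((penalty A y τ lam γ x + 1) / ‖v‖ ^ 2) • v)
    have h2 := penalty_nonneg A y τ (lam := lam) hγ
      (x - ((penalty A y τ lam γ x + 1) / ‖v‖ ^ 2) • v)
    rw [sub_sub_cancel_left, inner_neg_right, real_inner_smul_right, real_inner_self_eq_norm_sq,
      div_mul_cancel₀ _ hv0.ne'] at h1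
    linarith
  have h1 := hd z
  rw [hv, inner_zero_left, add_zero] at h1
  refine h1.not_gt (mul_lt_mul_of_pos_left (Real.log_lt_log (by positivity) ?_) hγ)
  have : lam * constr A y τ x / γ < lam * constr A y τ z / γ := by gcongr
  linarith [Real.exp_lt_exp.2 this]

end InnerLoop

/-! ### One epoch and the halving of the accuracy -/

section Epoch

variable {m d : ℕ} {A : Matrix (Fin m) (Fin d) ℝ} {y : Vec m} {τ : ℝ}

/-- Under the error bound, the distance to the `ε`-sublevel set is at most `σ δ / √ε` where `δ` is
the excess of the objective over `f_* + ε`. -/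
theorem exists_mem_sublevelSet_near {σ ε₁ ε δ : ℝ} (hσ : 0 ≤ σ)
    (heb : LocalErrorBound A y τ (1 / 2) σ ε₁) (hε : 0 < ε) (hε₁ : ε ≤ ε₁) (hδ : 0 ≤ δ)
    {x : Vec d} (hx : x ∈ feasibleSet A y τ) (hxδ : l1Norm x - optVal A y τ ≤ ε + δ) :
    ∃ z ∈ sublevelSet A y τ ε, ‖x - z‖ ≤ σ * δ / Real.sqrt ε := by
  have hsq : 0 < Real.sqrt ε := Real.sqrt_pos.2 hε
  rcases le_or_gt (l1Norm x) (optVal A y τ + ε) with hle | hgt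
  · refine ⟨x, ⟨hx, hle⟩, ?_⟩
    rw [sub_self, norm_zero]
    positivity
  have hne : (optSet A y τ).Nonempty := optSet_nonempty ⟨x, hx⟩
  have hSne : (sublevelSet A y τ ε).Nonempty := by
    obtain ⟨w, hw⟩ := hne
    exact ⟨w, hw.1, by rw [l1Norm_eq_optVal hw]; linarith⟩
  obtain ⟨z, hz, hzd⟩ := (isClosed_sublevelSet ε).exists_infDist_eq_dist hSne x
  obtain ⟨w, hw, hwd⟩ := isClosed_optSet.exists_infDist_eq_dist hne z
  refine ⟨z, hz, ?_⟩
  have hB : ‖z - w‖ ≤ σ * Real.sqrt ε := by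
    rw [← dist_eq_norm, ← hwd]
    refine (heb z ⟨hz.1, hz.2.trans (by linarith)⟩).trans ?_
    rw [← Real.sqrt_eq_rpow]
    gcongr
    linarith [hz.2]
  set η := l1Norm x - optVal A y τ - ε with hη
  have hη0 : 0 < η := by linarith
  have hηδ : η ≤ δ := by linarith
  -- At this fraction of the way from `x` to `w`, convexity puts the objective at most `ε` above the
  -- optimum. As `z` is nearest to `x`, `‖x - z‖ ≤ s‖x - w‖`, and solving for `‖x - z‖` cancels `η`
  -- against `ε + η`.
  set s := η / (ε + η) with hs
  have hden : 0 < ε + η := by positivity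
  have hse : s * (ε + η) = η := div_mul_cancel₀ _ hden.ne'
  have hs0 : 0 ≤ s := by positivity
  have hs1 : s ≤ 1 := (div_le_one hden).2 (by linarith)
  have hq : (1 - s) • x + s • w ∈ sublevelSet A y τ ε := by
    constructor
    · refine (constr_segment_le A y τ x w hs0 hs1).trans ?_
      have h1 : constr A y τ x ≤ 0 := hx
      have h2 : constr A y τ w ≤ 0 := hw.1
      nlinarith
    · refine (l1Norm_segment_le x w hs0 hs1).trans ?_
      rw [l1Norm_eq_optVal hw]
      nlinarith
  have h1 := Metric.infDist_le_dist_of_mem (x := x) hq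
  have e : x - ((1 - s) • x + s • w) = s • ((x - z) + (z - w)) := by module
  rw [hzd, dist_eq_norm, dist_eq_norm, e, norm_smul, Real.norm_eq_abs, abs_of_nonneg hs0] at h1
  have h2 : ‖x - z‖ ≤ s * (‖x - z‖ + σ * Real.sqrt ε) :=
    h1.trans (by gcongr; exact (norm_add_le _ _).trans (by gcongr))
  have h3 : ‖x - z‖ * ε ≤ η * (σ * Real.sqrt ε) := by
    have h4 := mul_le_mul_of_nonneg_right h2 hden.le
    rw [mul_right_comm, hse] at h4
    linarith
  rw [le_div_iff₀ hsq]
  have h4 : ‖x - z‖ * Real.sqrt ε * Real.sqrt ε ≤ η * σ * Real.sqrt ε := by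
    rw [mul_assoc, Real.mul_self_sqrt hε.le]
    linarith
  have h5 := le_of_mul_le_mul_right h4 hsq
  nlinarith

/-- The objective after one epoch. -/
theorem epoch_spec {ρ lam γ L ε D : ℝ} (hρ : 0 < ρ) (hreg : ConstraintRegular A y τ ρ)
    (hlam : Real.sqrt d / ρ < lam) (hγ : 0 < γ) (hL : 0 < L)
    (hsm : IsSmooth (penalty A y τ lam γ) L) {t : ℕ} (ht : 0 < t) (st : OuterState d)
    {z : Vec d} (hz : z ∈ sublevelSet A y τ ε) (hD : ‖st.point - z‖ ≤ D) :
    (epoch A y τ lam γ L t st).point ∈ feasibleSet A y τ ∧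
      l1Norm (epoch A y τ lam γ L t st).point - optVal A y τ
        ≤ ε + γ * Real.log 2 + 2 * L * D ^ 2 / (t : ℝ) ^ 2 := by
  have hlam0 : 0 < lam := lt_of_le_of_lt (by positivity) hlam
  have hlamρ : Real.sqrt d ≤ lam * ρ := ((div_lt_iff₀ hρ).1 hlam).le
  simp only [epoch]
  have hrate := innerLoop_rate hlam0.le hγ hL hsm st.point z ht
  generalize (innerLoop A y τ lam γ L st.point t).x = x at hrate ⊢
  refine ⟨(proj_spec ⟨z, hz.1⟩ x).1, ?_⟩
  have h1 := penalty_le_of_mem A y τ hlam0.le hγ hz.1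
  have h2 : lam * max (constr A y τ x) 0 ≤ penalty A y τ lam γ x := by
    rw [mul_max_of_nonneg _ _ hlam0.le, mul_zero]
    exact max_le (mul_constr_le_penalty A y τ hγ x) (penalty_nonneg A y τ hγ x)
  have h3 := hreg x
  rw [le_div_iff₀ hρ] at h3
  have h4 := l1Norm_sub_le (proj A y τ x) x
  have h5 : Real.sqrt d * ‖proj A y τ x - x‖ ≤ lam * max (constr A y τ x) 0 :=
    calc Real.sqrt d * ‖proj A y τ x - x‖ ≤ lam * ρ * ‖proj A y τ x - x‖ := by gcongr
      _ = lam * (‖proj A y τ x - x‖ * ρ) := by ring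
      _ ≤ _ := by gcongr
  have h6 : 2 * L * ‖st.point - z‖ ^ 2 / (t : ℝ) ^ 2 ≤ 2 * L * D ^ 2 / (t : ℝ) ^ 2 := by
    gcongr
  have h7 := hz.2
  linarith

/-- The parameters of an epoch make its error at most half of the current accuracy `e`. -/
theorem epoch_error_le {p lam Lc Gc σ ε e t : ℝ} (hp : 1 ≤ p) (hlam : 0 < lam) (hLc : 0 ≤ Lc)
    (hGc : 0 ≤ Gc) (hσ : 0 < σ) (hε : 0 < ε) (he : 0 < e) (ht0 : 0 < t)
    (ht : σ / Real.sqrt ε * max (lam * Gc * p * Real.sqrt (18 * Real.log 2))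
      (Real.sqrt (12 * p * (lam * Lc) * e)) ≤ t) :
    e / (6 * p * Real.log 2) * Real.log 2
      + 2 * smoothParam lam Lc Gc (e / (6 * p * Real.log 2)) * (σ * e / Real.sqrt ε) ^ 2 / t ^ 2
      ≤ e / 2 := by
  have hlog : 0 < Real.log 2 := Real.log_pos (by norm_num)
  have hp0 : 0 < p := by linarith
  have hsq : 0 < Real.sqrt ε := Real.sqrt_pos.2 hε
  have hα : 0 < σ / Real.sqrt ε := by positivity
  rw [mul_div_right_comm σ e]
  set α := σ / Real.sqrt ε
  have h1 : α ^ 2 * (lam ^ 2 * Gc ^ 2 * p ^ 2 * (18 * Real.log 2)) ≤ t ^ 2 := by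
    have h := pow_le_pow_left₀ (by positivity)
      ((mul_le_mul_of_nonneg_left (le_max_left _ _) hα.le).trans ht) 2
    rw [mul_pow, mul_pow _ (Real.sqrt _), Real.sq_sqrt (by positivity)] at h
    calc _ = α ^ 2 * ((lam * Gc * p) ^ 2 * (18 * Real.log 2)) := by ring
      _ ≤ _ := h
  have h2 : α ^ 2 * (12 * p * (lam * Lc) * e) ≤ t ^ 2 := by
    have h := pow_le_pow_left₀ (by positivity)
      ((mul_le_mul_of_nonneg_left (le_max_right _ _) hα.le).trans ht) 2
    rwa [mul_pow, Real.sq_sqrt (by positivity)] at h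
  have e1 : e / (6 * p * Real.log 2) * Real.log 2 = e / (6 * p) := by field_simp
  -- The two entries of the maximum match the two terms of the smoothness constant. Each contributes
  -- at most `e / (6p)`, as does `γ ln 2`; together they give `e / (2p) ≤ e / 2`.
  have e2 : 2 * smoothParam lam Lc Gc (e / (6 * p * Real.log 2)) * (α * e) ^ 2
      = e / (6 * p) * (α ^ 2 * (12 * p * (lam * Lc) * e))
        + e / (6 * p) * (α ^ 2 * (lam ^ 2 * Gc ^ 2 * p ^ 2 * (18 * Real.log 2))) := by
    rw [smoothParam]
    field_simp
    ring
  have hep : e / (6 * p) ≤ e / 6 := by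
    gcongr
    linarith
  have h3 : 2 * smoothParam lam Lc Gc (e / (6 * p * Real.log 2)) * (α * e) ^ 2 / t ^ 2
      ≤ 2 * (e / (6 * p)) := by
    rw [div_le_iff₀ (by positivity), e2]
    have hc : 0 ≤ e / (6 * p) := by positivity
    nlinarith [mul_le_mul_of_nonneg_left h1 hc, mul_le_mul_of_nonneg_left h2 hc]
  rw [e1]
  linarith

theorem loPNAG_projs (lam : ℝ) (L : ℝ → ℝ) (γ₁ : ℝ) (t : ℕ → ℕ) (x₀ : Vec d) (k : ℕ) :
    (loPNAG A y τ lam L γ₁ t x₀ k).projs = k := by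
  induction k with
  | zero => rfl
  | succ k ih => exact congrArg (· + 1) ih

theorem loPNAG_iters (lam : ℝ) (L : ℝ → ℝ) (γ₁ : ℝ) (t : ℕ → ℕ) (x₀ : Vec d) (k : ℕ) :
    (loPNAG A y τ lam L γ₁ t x₀ k).iters = ∑ j ∈ Finset.range k, t j := by
  induction k with
  | zero => rfl
  | succ k ih =>
    rw [Finset.sum_range_succ, ← ih]
    simp only [loPNAG, epoch, innerLoop_iters]

theorem one_le_gainFactor {lam ρ : ℝ} (hρ : 0 < ρ) (hlam : Real.sqrt d / ρ < lam) :
    1 ≤ gainFactor d lam ρ := by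
  have h := (div_lt_iff₀ hρ).1 hlam
  rw [gainFactor, one_le_div (by linarith)]
  linarith [Real.sqrt_nonneg (d : ℝ)]

/-- Every epoch halves the accuracy, up to the target `ε`. -/
theorem loPNAG_spec {ρ lam Lc Gc ε₀ ε₁ σ ε : ℝ} (hzero : (0 : Vec d) ∉ optSet A y τ)
    (hslater : ∃ x₀ : Vec d, constr A y τ x₀ < 0)
    (hρ : 0 < ρ) (hreg : ConstraintRegular A y τ ρ)
    (hlam : Real.sqrt d / ρ < lam) (hLc : 0 ≤ Lc) (hGc : 0 ≤ Gc)
    (hsm : ∀ γ : ℝ, 0 < γ → IsSmooth (penalty A y τ lam γ) (smoothParam lam Lc Gc γ))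
    (hε₀ : 0 < ε₀) (hσ : 0 < σ) (heb : LocalErrorBound A y τ (1 / 2) σ ε₁)
    (hε : 0 < ε) (hε₁ : ε ≤ ε₁) {x₀ : Vec d} (hx₀ : x₀ ∈ feasibleSet A y τ)
    (hfx₀ : l1Norm x₀ - optVal A y τ ≤ ε₀) (k : ℕ) :
    (loPNAG A y τ lam (smoothParam lam Lc Gc) (initGamma (gainFactor d lam ρ) ε₀)
        (epochLength lam Lc Gc (gainFactor d lam ρ) σ ε₀ ε) x₀ k).point ∈ feasibleSet A y τ ∧
      l1Norm (loPNAG A y τ lam (smoothParam lam Lc Gc) (initGamma (gainFactor d lam ρ) ε₀)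
        (epochLength lam Lc Gc (gainFactor d lam ρ) σ ε₀ ε) x₀ k).point - optVal A y τ
        ≤ ε + ε₀ / 2 ^ k := by
  have hp := one_le_gainFactor hρ hlam
  set p := gainFactor d lam ρ
  have hp0 : 0 < p := by linarith
  have hlam0 : 0 < lam := lt_of_le_of_lt (by positivity) hlam
  have hlog : 0 < Real.log 2 := Real.log_pos (by norm_num)
  induction k with
  | zero =>
    refine ⟨hx₀, ?_⟩
    simp only [loPNAG, pow_zero, div_one]
    linarith
  | succ k ih =>
    rw [loPNAG]
    set st := loPNAG A y τ lam (smoothParam lam Lc Gc) (initGamma p ε₀)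
      (epochLength lam Lc Gc p σ ε₀ ε) x₀ k
    have he : 0 < ε₀ / 2 ^ k := by positivity
    have hγe : initGamma p ε₀ / 2 ^ k = ε₀ / 2 ^ k / (6 * p * Real.log 2) := by
      rw [initGamma, div_right_comm]
    have hγ : 0 < initGamma p ε₀ / 2 ^ k := by
      rw [hγe]
      positivity
    obtain ⟨x₁, hx₁⟩ := hslater
    -- The penalty is not constant, since `c` is negative at `x₁` and positive at `0`. Positivity of
    -- `L` also rules out `Lc = Gc = 0`, hence an epoch of length zero.
    have hL := (hsm _ hγ).penalty_pos hlam0 hγ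
      (hx₁.trans (constr_zero_pos ⟨x₁, hx₁.le⟩ hzero))
    have ht : σ / Real.sqrt ε * max (lam * Gc * p * Real.sqrt (18 * Real.log 2))
        (Real.sqrt (12 * p * (lam * Lc) * (ε₀ / 2 ^ k))) ≤ epochLength lam Lc Gc p σ ε₀ ε k :=
      Nat.le_ceil _
    have ht0 : 0 < epochLength lam Lc Gc p σ ε₀ ε k := by
      refine Nat.ceil_pos.2 (mul_pos (div_pos hσ (Real.sqrt_pos.2 hε)) ?_)
      rcases hLc.eq_or_lt with h | h
      · have hG : 0 < Gc := hGc.lt_of_ne fun hG => by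
          rw [← h, ← hG] at hL
          simp [smoothParam] at hL
        exact lt_max_of_lt_left (by positivity)
      · exact lt_max_of_lt_right (by positivity)
    obtain ⟨z, hz, hzd⟩ := exists_mem_sublevelSet_near hσ.le heb hε hε₁ he.le ih.1 ih.2
    have hE := epoch_spec hρ hreg hlam hγ hL (hsm _ hγ) ht0 st hz hzd
    refine ⟨hE.1, hE.2.trans ?_⟩
    have herr := epoch_error_le hp hlam0 hLc hGc hσ hε he (Nat.cast_pos.2 ht0) ht
    rw [← hγe] at herr
    have hh : ε₀ / 2 ^ (k + 1) = ε₀ / 2 ^ k / 2 := by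
      rw [pow_succ, div_mul_eq_div_div]
    rw [hh]
    linarith

end Epoch

/-! ### Counting epochs and iterations -/

section Complexity

theorem div_two_pow_numEpochs_le {ε₀ ε : ℝ} (hε : 0 < ε) (hε₀ : 0 < ε₀) :
    ε₀ / 2 ^ numEpochs ε₀ ε ≤ ε := by
  have h : Real.logb 2 (ε₀ / ε) ≤ numEpochs ε₀ ε := Nat.le_ceil _
  rw [Real.logb_le_iff_le_rpow (by norm_num) (by positivity), Real.rpow_natCast] at h
  rw [div_le_iff₀ (by positivity)]
  rwa [div_le_iff₀ hε, mul_comm] at h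

/-- Since `ε ≤ 1 / 2`, `log (1 / ε) / log 2 ≥ 1`, so the rounding and the constant `log ε₀` are
absorbed into multiples of `log (1 / ε)`. -/
theorem exists_numEpochs_le (ε₀ : ℝ) : ∃ Q : ℝ, 0 ≤ Q ∧ ∀ ε : ℝ, 0 < ε → ε < ε₀ → ε ≤ 1 / 2 →
    (numEpochs ε₀ ε : ℝ) ≤ Q * Real.log (1 / ε) := by
  have hlog : 0 < Real.log 2 := Real.log_pos (by norm_num)
  refine ⟨|Real.log ε₀| / Real.log 2 ^ 2 + 2 / Real.log 2, by positivity,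
    fun ε hε hεε₀ hε2 => ?_⟩
  have hε₀ : 0 < ε₀ := hε.trans hεε₀
  have hl : Real.log 2 ≤ Real.log (1 / ε) := by
    refine Real.log_le_log (by norm_num) ?_
    rw [le_div_iff₀ hε]
    linarith
  have hnn : 0 ≤ Real.logb 2 (ε₀ / ε) :=
    Real.logb_nonneg (by norm_num) ((one_le_div hε).2 hεε₀.le)
  refine (Nat.ceil_lt_add_one hnn).le.trans ?_
  have e : Real.log (ε₀ / ε) = Real.log ε₀ + Real.log (1 / ε) := by
    rw [← Real.log_mul hε₀.ne' (by positivity), mul_one_div]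
  rw [Real.logb, e]
  set l := Real.log (1 / ε)
  have h1 : 1 ≤ l / Real.log 2 := (one_le_div hlog).2 hl
  calc (Real.log ε₀ + l) / Real.log 2 + 1
      ≤ (|Real.log ε₀| + l) / Real.log 2 + 1 := by
        gcongr
        exact le_abs_self _
    _ = |Real.log ε₀| / Real.log 2 * 1 + l / Real.log 2 + 1 := by ring
    _ ≤ |Real.log ε₀| / Real.log 2 * (l / Real.log 2) + l / Real.log 2 + l / Real.log 2 := by
        gcongr
    _ = _ := by ring

theorem epochLength_le {lam Lc Gc p σ ε₀ ε : ℝ} (hp : 0 ≤ p) (hlam : 0 ≤ lam) (hLc : 0 ≤ Lc)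
    (hσ : 0 ≤ σ) (hε₀ : 0 ≤ ε₀) (hε : 0 < ε) (hε1 : ε ≤ 1) (k : ℕ) :
    (epochLength lam Lc Gc p σ ε₀ ε k : ℝ) ≤
      (σ * max (lam * Gc * p * Real.sqrt (18 * Real.log 2))
        (Real.sqrt (12 * p * (lam * Lc) * ε₀)) + 1) / Real.sqrt ε := by
  have hsq : 0 < Real.sqrt ε := Real.sqrt_pos.2 hε
  have h1 : 1 ≤ 1 / Real.sqrt ε := (one_le_div hsq).2 (Real.sqrt_le_one.2 hε1)
  have hmax : 0 ≤ max (lam * Gc * p * Real.sqrt (18 * Real.log 2))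
      (Real.sqrt (12 * p * (lam * Lc) * (ε₀ / 2 ^ k))) := le_max_of_le_right (Real.sqrt_nonneg _)
  refine (Nat.ceil_lt_add_one (by positivity)).le.trans ?_
  have hk : ε₀ / 2 ^ k ≤ ε₀ := div_le_self hε₀ (one_le_pow₀ (by norm_num))
  rw [add_div, mul_div_right_comm]
  refine add_le_add ?_ h1
  gcongr

end Complexity

end CompressiveSensing


theorem mainTheorem6 {m d : ℕ} (A : Matrix (Fin m) (Fin d) ℝ)
    (y : CompressiveSensing.Vec m) (τ : ℝ)
    (hslater : ∃ x₀ : CompressiveSensing.Vec d, CompressiveSensing.constr A y τ x₀ < 0)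
    (hzero : (0 : CompressiveSensing.Vec d) ∉ CompressiveSensing.optSet A y τ) :
    -- the optimal set is non-empty, and the local error bound holds with exponent 1/2
    (CompressiveSensing.optSet A y τ).Nonempty ∧
    (∀ ε : ℝ, 0 < ε → ∃ σ : ℝ, 0 < σ ∧ CompressiveSensing.LocalErrorBound A y τ (1 / 2) σ ε) ∧
    -- the constants that the algorithm is run with exist
    (∃ ρ : ℝ, 0 < ρ ∧ CompressiveSensing.ConstraintRegular A y τ ρ) ∧
    (∃ Lc Gc : ℝ, 0 < Lc ∧ 0 < Gc ∧ ∀ lam γ : ℝ, 0 < lam → 0 < γ →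
      CompressiveSensing.IsSmooth (CompressiveSensing.penalty A y τ lam γ)
        (CompressiveSensing.smoothParam lam Lc Gc γ)) ∧
    -- complexity of LoPNAG, for all such constants
    ∀ ρ lam Lc Gc : ℝ, 0 < ρ → CompressiveSensing.ConstraintRegular A y τ ρ →
      Real.sqrt d / ρ < lam → 0 ≤ Lc → 0 ≤ Gc →
      (∀ γ : ℝ, 0 < γ → CompressiveSensing.IsSmooth (CompressiveSensing.penalty A y τ lam γ)
        (CompressiveSensing.smoothParam lam Lc Gc γ)) →
      ∀ ε₀ ε₁ σ : ℝ, 0 < ε₀ → 0 < ε₁ → 0 < σ →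
        CompressiveSensing.LocalErrorBound A y τ (1 / 2) σ ε₁ →
        ∃ C : ℝ, ∀ ε : ℝ, 0 < ε → ε < ε₀ → ε ≤ ε₁ → ε ≤ 1 / 2 →
          ∀ x₀ ∈ CompressiveSensing.feasibleSet A y τ,
            CompressiveSensing.l1Norm x₀ - CompressiveSensing.optVal A y τ ≤ ε₀ →
            let p := CompressiveSensing.gainFactor d lam ρ
            let out := CompressiveSensing.loPNAG A y τ lam
              (CompressiveSensing.smoothParam lam Lc Gc)
              (CompressiveSensing.initGamma p ε₀)
              (CompressiveSensing.epochLength lam Lc Gc p σ ε₀ ε) x₀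
              (CompressiveSensing.numEpochs ε₀ ε)
            out.point ∈ CompressiveSensing.feasibleSet A y τ ∧
            CompressiveSensing.l1Norm out.point - CompressiveSensing.optVal A y τ ≤ 2 * ε ∧
            (out.iters : ℝ) ≤ C / Real.sqrt ε * Real.log (1 / ε) ∧
            (out.projs : ℝ) ≤ C * Real.log (1 / ε) := by

  obtain ⟨x₁, hx₁⟩ := hslater
  have hne : (CompressiveSensing.feasibleSet A y τ).Nonempty := ⟨x₁, hx₁.le⟩
  have hτ : 0 ≤ τ := by
    have h : ‖CompressiveSensing.opA A x₁ - y‖ ^ 2 - τ < 0 := hx₁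
    nlinarith [sq_nonneg ‖CompressiveSensing.opA A x₁ - y‖]
  refine ⟨CompressiveSensing.optSet_nonempty hne,
    fun ε hε => CompressiveSensing.exists_localErrorBound hne hzero hε,
    CompressiveSensing.exists_constraintRegular ⟨x₁, hx₁⟩,
    CompressiveSensing.exists_isSmooth_penalty A y τ hτ, ?_⟩
  intro ρ lam Lc Gc hρ hreg hlam hLc hGc hsm ε₀ ε₁ σ hε₀ _ hσ heb
  have hp := CompressiveSensing.one_le_gainFactor hρ hlam
  have hlam0 : 0 < lam := lt_of_le_of_lt (by positivity) hlam
  obtain ⟨Q, hQ, hK⟩ := CompressiveSensing.exists_numEpochs_le ε₀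
  set p := CompressiveSensing.gainFactor d lam ρ
  set M := σ * max (lam * Gc * p * Real.sqrt (18 * Real.log 2))
    (Real.sqrt (12 * p * (lam * Lc) * ε₀)) with hM
  have hM0 : 0 ≤ M := mul_nonneg hσ.le (le_max_of_le_right (Real.sqrt_nonneg _))
  -- An epoch costs at most `(M + 1) / √ε` iterations, the 1 covering the ceiling, and there are at
  -- most `Q log (1 / ε)` epochs. As `M ≥ 0`, the same constant bounds the projections.
  refine ⟨Q * (M + 1), fun ε hε hεε₀ hεε₁ hε2 x₀ hx₀ hfx₀ => ?_⟩
  intro p' out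
  have hspec := CompressiveSensing.loPNAG_spec hzero ⟨x₁, hx₁⟩ hρ hreg hlam hLc hGc hsm hε₀ hσ heb
    hε hεε₁ hx₀ hfx₀ (CompressiveSensing.numEpochs ε₀ ε)
  have hl : 0 ≤ Real.log (1 / ε) := Real.log_nonneg ((one_le_div hε).2 (by linarith))
  have hKε := hK ε hε hεε₀ hε2
  refine ⟨hspec.1, ?_, ?_, ?_⟩
  · have := CompressiveSensing.div_two_pow_numEpochs_le hε hε₀
    linarith [hspec.2]
  · have hit : out.iters = ∑ j ∈ Finset.range (CompressiveSensing.numEpochs ε₀ ε),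
        CompressiveSensing.epochLength lam Lc Gc p σ ε₀ ε j :=
      CompressiveSensing.loPNAG_iters ..
    rw [hit]
    push_cast
    calc ∑ j ∈ Finset.range (CompressiveSensing.numEpochs ε₀ ε),
          (CompressiveSensing.epochLength lam Lc Gc p σ ε₀ ε j : ℝ)
        ≤ ∑ _j ∈ Finset.range (CompressiveSensing.numEpochs ε₀ ε), (M + 1) / Real.sqrt ε :=
          Finset.sum_le_sum fun j _ => CompressiveSensing.epochLength_le (by linarith) hlam0.le hLc
            hσ.le hε₀.le hε (by linarith) j
      _ = CompressiveSensing.numEpochs ε₀ ε * ((M + 1) / Real.sqrt ε) := by simp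
      _ ≤ Q * Real.log (1 / ε) * ((M + 1) / Real.sqrt ε) := by gcongr
      _ = _ := by ring
  · have hpr : out.projs = CompressiveSensing.numEpochs ε₀ ε := CompressiveSensing.loPNAG_projs ..
    rw [hpr]
    refine hKε.trans (mul_le_mul_of_nonneg_right ?_ hl)
    nlinarith
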